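/- Let $\mathcal H$ be a separable complex Hilbert space. A state on $\mathcal H$ is a positive trace class operator $\rho$ with $\operatorname{Tr}\rho=1$. Let $\{\lambda_i^\rho\}_{i\ge 1}$ be the non-increasing sequence of the positive eigenvalues of $\rho$, repeated according to multiplicity and continued by zeros if $\rho$ has finite rank. The von Neumann entropy is $H(\rho)=\operatorname{Tr}\eta(\rho)\in[0,\infty]$, where $\eta(x)=-x\ln x$ for $x>0$ and $\eta(0)=0$. The relative entropy of states $\rho,\sigma$ is $$H(\rho\|\sigma)=\sum_i\langle\varphi_i|\,\rho\ln\rho-\rho\ln\sigma\,|\varphi_i\rangle,$$ where $\{\varphi_i\}$ is an orthonormal basis of eigenvectors of $\rho$, if $\operatorname{supp}\rho\subseteq\operatorname{supp}\sigma$, and $H(\rho\|\sigma)=+\infty$ otherwise; the support of a state is the closed span of its eigenvectors with positive eigenvalues. A positive operator $G$ on $\mathcal H$ is a (possibly unbounded) self-adjoint operator with $\langle x,Gx\rangle\ge 0$ on its domain, and $\operatorname{Tr}G\rho=\sup_n\operatorname{Tr}P_nG\rho\in[0,\infty]$, where $P_n$ is the spectral projector of $G$ for $[0,n]$. Theorem.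 For every state $\rho$ on $\mathcal H$ the following properties are equivalent: (i) (FA-property) there is a sequence $\{g_i\}_{i\ge 1}$ of nonnegative numbers such that $$\sum_{i=1}^{\infty}\lambda_i^\rho g_i<+\infty\quad\text{and}\quad\lim_{\beta\to0^+}\Bigl[\sum_{i=1}^{\infty}e^{-\beta g_i}\Bigr]^{\beta}=1;$$ (ii) there is a positive operator $G$ on $\mathcal H$ such that $\lim_{\beta\to0^+}\bigl[\operatorname{Tr}e^{-\beta G}\bigr]^{\beta}=1$ and $\operatorname{Tr}G\rho<+\infty$; (iii) $H(\rho)<+\infty$, and $H(\rho\|\sigma)<+\infty$ for some state $\sigma$ on $\mathcal H$ such that $\operatorname{Tr}\sigma^q<+\infty$ for all $q>0$ and $\lim_{q\to0^+}\bigl[\operatorname{Tr}\sigma^q\bigr]^q=1$. The equivalent properties (i)–(iii) hold provided that $\sum_{i=1}^{\infty}\lambda_i^\rho\ln^q i<+\infty$ for some $q>2$. -/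

import Mathlib

open Filter Topology MeasureTheory Set
open scoped ENNReal InnerProductSpace

namespace QState

universe u

variable {H : Type u} [NormedAddCommGroup H] [InnerProductSpace ℂ H] [CompleteSpace H]

/-! ### Traces of positive bounded operators -/

/-- Index set of an orthonormal basis of `H`, fixed once and for all. -/
noncomputable def stdIndex (H : Type u) [NormedAddCommGroup H] [InnerProductSpace ℂ H]
    [CompleteSpace H] : Set H :=
  (exists_hilbertBasis ℂ H).choose

/-- An orthonormal basis of `H`, fixed once and for all. -/
noncomputable def stdBasis (H : Type u) [NormedAddCommGroup H] [InnerProductSpace ℂ H]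
    [CompleteSpace H] : HilbertBasis (stdIndex H) ℂ H :=
  (exists_hilbertBasis ℂ H).choose_spec.choose

/-- The trace `∑ᵢ ⟨eᵢ, A eᵢ⟩ ∈ [0, ∞]` of a positive bounded operator `A`
(it does not depend on the orthonormal basis). -/
noncomputable def posTrace (A : H →L[ℂ] H) : ℝ≥0∞ :=
  ∑' i, ENNReal.ofReal (RCLike.re ⟪stdBasis H i, A (stdBasis H i)⟫_ℂ)

/-! ### Positive operators of finite trace are diagonalizable -/

theorem norm_sqrt_sq {A : H →L[ℂ] H} (hA : A.IsPositive) (x : H) :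
    ‖CFC.sqrt A x‖ ^ 2 = RCLike.re ⟪x, A x⟫_ℂ := by
  have h0 : 0 ≤ A := (ContinuousLinearMap.nonneg_iff_isPositive A).2 hA
  have hS : (CFC.sqrt A).IsPositive :=
    (ContinuousLinearMap.nonneg_iff_isPositive _).1 (CFC.sqrt_nonneg A)
  have h1 : CFC.sqrt A * CFC.sqrt A = A := CFC.sqrt_mul_sqrt_self A h0
  have h2 : A x = CFC.sqrt A (CFC.sqrt A x) := by
    conv_lhs => rw [← h1]
    rfl
  rw [h2, ← hS.inner_left_eq_inner_right, inner_self_eq_norm_sq]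

theorem isCompactOperator_of_posTrace {A : H →L[ℂ] H} (hA : A.IsPositive)
    (ht : posTrace A ≠ ⊤) : IsCompactOperator A := by
  set S := CFC.sqrt A with hSdef
  have h0 : 0 ≤ A := (ContinuousLinearMap.nonneg_iff_isPositive A).2 hA
  set b := stdBasis H
  have hsum : Summable fun i => ‖S (b i)‖ ^ 2 := by
    have h := ENNReal.summable_toReal ht
    refine h.congr fun i => ?_
    rw [ENNReal.toReal_ofReal (hA.re_inner_nonneg_right _), norm_sqrt_sq hA]
  let T : Finset (stdIndex H) → H →L[ℂ] H := fun F =>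
    ∑ i ∈ F, (innerSL ℂ (b i)).smulRight (S (b i))
  have hTapp : ∀ F x, T F x = ∑ i ∈ F, ⟪b i, x⟫_ℂ • S (b i) := by
    intro F x
    simp [T]
  have hTc : ∀ F, IsCompactOperator (T F) := by
    intro F
    have hmem : T F ∈ compactOperator (RingHom.id ℂ) H H := by
      refine Submodule.sum_mem _ fun i _ => ?_
      have : IsCompactOperator (((innerSL ℂ (b i)).smulRight (S (b i)) : H →L[ℂ] H)) := by
        have hid : IsCompactOperator (ContinuousLinearMap.id ℂ ℂ) := by
          refine ⟨Metric.closedBall 0 1, isCompact_closedBall _ _, ?_⟩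
          exact Metric.closedBall_mem_nhds _ one_pos
        have h2 := (hid.comp_clm (innerSL ℂ (b i))).clm_comp
          (ContinuousLinearMap.toSpanSingleton ℂ (S (b i)))
        exact h2
      exact this
    exact hmem
  have hlim : ∀ x, Tendsto (fun F => T F x) atTop (𝓝 (S x)) := by
    intro x
    have h := (b.hasSum_repr x).mapL S
    simp only [map_smul, b.repr_apply_apply] at h
    simp only [hTapp]
    exact h
  have hS : IsCompactOperator S := by
    have hcl : IsClosed {f : H →L[ℂ] H | IsCompactOperator f} := isClosed_setOfPred_isCompactOperator
    have : S ∈ closure {f : H →L[ℂ] H | IsCompactOperator f} := by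
      rw [Metric.mem_closure_iff]
      intro ε hε
      obtain ⟨F, hF⟩ := summable_iff_vanishing_norm.1 hsum ((ε / 2) ^ 2) (by positivity)
      refine ⟨T F, hTc F, ?_⟩
      rw [dist_eq_norm]
      refine lt_of_le_of_lt ?_ (half_lt_self hε)
      refine ContinuousLinearMap.opNorm_le_bound _ (by positivity) fun x => ?_
      have hl : Tendsto (fun G => ‖T G x - T F x‖) atTop (𝓝 ‖S x - T F x‖) :=
        ((hlim x).sub_const _).norm
      refine le_of_tendsto hl ?_
      filter_upwards [eventually_ge_atTop F] with G hG
      classical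
      have hd : T G x - T F x = ∑ i ∈ G \ F, ⟪b i, x⟫_ℂ • S (b i) := by
        rw [hTapp, hTapp, Finset.sum_sdiff_eq_sub hG]
      rw [hd]
      have h1 : ‖∑ i ∈ G \ F, ⟪b i, x⟫_ℂ • S (b i)‖ ≤ ∑ i ∈ G \ F, ‖⟪b i, x⟫_ℂ‖ * ‖S (b i)‖ :=
        (norm_sum_le _ _).trans (le_of_eq (by simp [norm_smul]))
      refine h1.trans ?_
      refine abs_le_of_sq_le_sq' ?_ (by positivity) |>.2
      refine (Finset.sum_mul_sq_le_sq_mul_sq _ _ _).trans ?_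
      have h2 : ∑ i ∈ G \ F, ‖⟪b i, x⟫_ℂ‖ ^ 2 ≤ ‖x‖ ^ 2 :=
        b.orthonormal.sum_inner_products_le x
      have h3 := hF (G \ F) Finset.sdiff_disjoint
      rw [Real.norm_of_nonneg (by positivity)] at h3
      rw [mul_pow, mul_comm]
      exact mul_le_mul h3.le h2 (by positivity) (by positivity)
    exact hcl.closure_subset this
  have h1 : S * S = A := CFC.sqrt_mul_sqrt_self A h0
  rw [← h1]
  exact hS.comp_clm S

theorem exists_eigenbasis {A : H →L[ℂ] H} (hA : A.IsPositive) (ht : posTrace A ≠ ⊤) :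
    ∃ (ι : Type u) (b : HilbertBasis ι ℂ H) (l : ι → ℝ), ∀ i, A (b i) = (l i : ℂ) • b i := by
  have hc := isCompactOperator_of_posTrace hA ht
  have hsym : (A : H →ₗ[ℂ] H).IsSymmetric := hA.isSymmetric
  let V : ℂ → Submodule ℂ H := fun t => Module.End.eigenspace (A : H →ₗ[ℂ] H) t
  have hcl : ∀ t, IsClosed (V t : Set H) := by
    intro t
    have : (V t : Set H) = {x | A x = t • x} := by
      ext x
      simp [V]
    rw [this]
    exact isClosed_eq A.continuous (by fun_prop)
  have : ∀ t, CompleteSpace (V t) := fun t => (hcl t).completeSpace_coe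
  choose w c hw using fun t => exists_hilbertBasis ℂ (V t)
  have hfam := hsym.orthogonalFamily_eigenspaces
  have hon : Orthonormal ℂ fun a : Σ t, w t => (V a.1).subtypeₗᵢ (c a.1 a.2) :=
    hfam.orthonormal_sigma_orthonormal (v_family := fun t => (c t)) fun t => (c t).orthonormal
  have hsp : (Submodule.span ℂ (range fun a : Σ t, w t => (V a.1).subtypeₗᵢ (c a.1 a.2)))ᗮ = ⊥ := by
    rw [eq_bot_iff]
    intro x hx
    have hbot := ContinuousLinearMap.orthogonalComplement_iSup_eigenspaces_eq_bot hc hsym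
    rw [← hbot]
    rw [Submodule.mem_orthogonal]
    intro y hy
    have hle : (⨆ t, V t) ≤ (Submodule.span ℂ {x})ᗮ := by
      refine iSup_le fun t z hz => ?_
      rw [Submodule.mem_orthogonal_singleton_iff_inner_left]
      have hd := (c t).hasSum_repr ⟨z, hz⟩
      have hd2 := (hd.mapL (V t).subtypeL).mapL (innerSL ℂ x)
      have hz0 : ⟪x, z⟫_ℂ = 0 := by
        refine hd2.unique ?_
        convert hasSum_zero with i
        have : ⟪x, ((c t i : V t) : H)⟫_ℂ = 0 := by
          rw [Submodule.mem_orthogonal'] at hx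
          exact hx _ (Submodule.subset_span ⟨⟨t, i⟩, rfl⟩)
        simp [this]
      rw [← inner_conj_symm, hz0, map_zero]
    have := hle hy
    rwa [Submodule.mem_orthogonal_singleton_iff_inner_left] at this
  refine ⟨Σ t, w t, HilbertBasis.mkOfOrthogonalEqBot hon hsp, fun a => a.1.re, fun a => ?_⟩
  rw [HilbertBasis.coe_mkOfOrthogonalEqBot]
  have hmem : ((c a.1 a.2 : V a.1) : H) ∈ V a.1 := (c a.1 a.2).2
  have heq := Module.End.mem_eigenspace_iff.1 hmem
  have hne : ((c a.1 a.2 : V a.1) : H) ≠ 0 := by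
    have := hon.ne_zero a
    simpa using this
  have hconj := hsym.conj_eigenvalue_eq_self
    (Module.End.hasEigenvalue_of_hasEigenvector ⟨hmem, hne⟩)
  have hre : ((a.1.re : ℝ) : ℂ) = a.1 := Complex.conj_eq_iff_re.1 hconj
  simp only [Submodule.coe_subtypeₗᵢ, Submodule.subtype_apply]
  rw [hre]
  exact heq

/-! ### States -/

/-- A quantum state on `H`: a positive trace class operator of unit trace. -/
structure State (H : Type u) [NormedAddCommGroup H] [InnerProductSpace ℂ H]
    [CompleteSpace H] where
  op : H →L[ℂ] H
  isPositive : op.IsPositive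
  trace_eq_one : posTrace op = 1

namespace State

theorem exists_basis (ρ : State H) :
    ∃ (ι : Type u) (b : HilbertBasis ι ℂ H) (l : ι → ℝ), ∀ i, ρ.op (b i) = (l i : ℂ) • b i :=
  exists_eigenbasis ρ.isPositive (by rw [ρ.trace_eq_one]; exact ENNReal.one_ne_top)

/-- Index set of an orthonormal basis of eigenvectors of `ρ`. -/
def Index (ρ : State H) : Type u := ρ.exists_basis.choose

/-- An orthonormal basis `φ` of `H` that consists of eigenvectors of `ρ`. -/
noncomputable def basis (ρ : State H) : HilbertBasis ρ.Index ℂ H :=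
  ρ.exists_basis.choose_spec.choose

/-- The eigenvalue of `ρ` at the basis eigenvector `φ i`. -/
noncomputable def eigenvalue (ρ : State H) : ρ.Index → ℝ :=
  ρ.exists_basis.choose_spec.choose_spec.choose

theorem op_basis (ρ : State H) (i : ρ.Index) :
    ρ.op (ρ.basis i) = (ρ.eigenvalue i : ℂ) • ρ.basis i :=
  ρ.exists_basis.choose_spec.choose_spec.choose_spec i

/-- The non-increasing sequence `λ₀ ≥ λ₁ ≥ …` of the eigenvalues of `ρ`, with multiplicity, padded
with zeros if `ρ` has finite rank: `λₙ` is the largest `t > 0` such that more than `n` eigenvalues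
are at least `t`, and `0` if there is no such `t`. -/
noncomputable def eigenvalueSeq (ρ : State H) (n : ℕ) : ℝ :=
  sSup {t : ℝ | 0 < t ∧ (n : ℕ∞) < {i : ρ.Index | t ≤ ρ.eigenvalue i}.encard}

/-- The von Neumann entropy `Tr η(ρ)`, where `η x = - x log x`. -/
noncomputable def entropy (ρ : State H) : ℝ≥0∞ := posTrace (cfc Real.negMulLog ρ.op)

/-- The support of `ρ`: the closed subspace spanned by the eigenvectors of `ρ` that
correspond to positive eigenvalues. -/
noncomputable def supp (ρ : State H) : Submodule ℂ H :=
  (⨆ t : {t : ℝ // 0 < t},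
    Module.End.eigenspace (ρ.op : H →ₗ[ℂ] H) ((t : ℝ) : ℂ)).topologicalClosure

/-- The value `⟨x, (- log σ) x⟩ = ∑ⱼ (- log μⱼ) |⟨ψⱼ, x⟩|² ∈ [0, ∞]` for `x` in the support of `σ`,
where `σ = ∑ⱼ μⱼ |ψⱼ⟩⟨ψⱼ|`. -/
noncomputable def negLogForm (σ : State H) (x : H) : ℝ≥0∞ :=
  ∑' j, ENNReal.ofReal (-Real.log (σ.eigenvalue j)) * ENNReal.ofReal (‖⟪σ.basis j, x⟫_ℂ‖ ^ 2)

/-- The summand `⟨φᵢ, (ρ log ρ - ρ log σ) φᵢ⟩ ∈ (-∞, ∞]` of the relative entropy. -/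
noncomputable def relEntropyTerm (ρ σ : State H) (i : ρ.Index) : EReal :=
  ((ρ.eigenvalue i * Real.log (ρ.eigenvalue i) : ℝ) : EReal) +
    ((ENNReal.ofReal (ρ.eigenvalue i) * σ.negLogForm (ρ.basis i) : ℝ≥0∞) : EReal)

open Classical in
/-- The quantum relative entropy `H(ρ‖σ) = ∑ᵢ ⟨φᵢ, (ρ log ρ - ρ log σ) φᵢ⟩`, which is `∞` if the
support of `ρ` is not contained in that of `σ`. The sum is the sum of the positive parts minus the
sum of the negative parts of the summands; the latter sum is finite. -/
noncomputable def relEntropy (ρ σ : State H) : EReal :=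
  if ρ.supp ≤ σ.supp then
    ((∑' i, (relEntropyTerm ρ σ i).toENNReal : ℝ≥0∞) : EReal) -
      ((∑' i, (-relEntropyTerm ρ σ i).toENNReal : ℝ≥0∞) : EReal)
  else ⊤

/-- The FA-property of a state. -/
def FAProperty (ρ : State H) : Prop :=
  ∃ g : ℕ → ℝ, (∀ i, 0 ≤ g i) ∧
    (∑' i, ENNReal.ofReal (ρ.eigenvalueSeq i * g i)) < ⊤ ∧
    Tendsto (fun β : ℝ => (∑' i, ENNReal.ofReal (Real.exp (-β * g i))) ^ β) (𝓝[>] 0) (𝓝 1)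

end State

/-! ### Unbounded positive operators and their spectral measures -/

/-- A projection-valued measure on the real line. -/
structure PVM (H : Type u) [NormedAddCommGroup H] [InnerProductSpace ℂ H]
    [CompleteSpace H] where
  proj : Set ℝ → H →L[ℂ] H
  isStarProjection : ∀ s, MeasurableSet s → IsStarProjection (proj s)
  proj_univ : proj univ = 1
  proj_inter : ∀ s t, MeasurableSet s → MeasurableSet t → proj (s ∩ t) = proj s * proj t
  hasSum_iUnion : ∀ s : ℕ → Set ℝ, (∀ n, MeasurableSet (s n)) → Pairwise (Function.onFun Disjoint s) →
    ∀ x, HasSum (fun n => proj (s n) x) (proj (⋃ n, s n) x)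

namespace PVM

theorem proj_empty (E : PVM H) : E.proj ∅ = 0 := by
  ext x
  have h := E.hasSum_iUnion (fun _ => ∅) (fun _ => MeasurableSet.empty)
    (fun _ _ _ => disjoint_bot_left) x
  exact (summable_const_iff _).1 h.summable

theorem re_inner_nonneg (E : PVM H) {s : Set ℝ} (hs : MeasurableSet s) (x : H) :
    0 ≤ RCLike.re ⟪x, E.proj s x⟫_ℂ :=
  ((ContinuousLinearMap.nonneg_iff_isPositive _).1
    (E.isStarProjection s hs).nonneg).re_inner_nonneg_right x

/-- The scalar spectral measure `s ↦ ⟨x, E(s) x⟩`. -/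
noncomputable def measure (E : PVM H) (x : H) : Measure ℝ :=
  Measure.ofMeasurable (fun s _ => ENNReal.ofReal (RCLike.re ⟪x, E.proj s x⟫_ℂ))
    (by simp [proj_empty])
    (by
      intro s hs hd
      have h := ((E.hasSum_iUnion s hs hd x).mapL (innerSL ℂ x)).mapL RCLike.reCLM
      simp only [innerSL_apply_apply, RCLike.reCLM_apply] at h
      rw [← h.tsum_eq]
      exact ENNReal.ofReal_tsum_of_nonneg (fun n => E.re_inner_nonneg (hs n) x) h.summable)

/-- `E` is the spectral measure of `G`, that is `G = ∫ t dE(t)`: the domain of `G` is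
`{x | ∫ t² d⟨x, E(t) x⟩ < ∞}`, and `⟨x, G x⟩ = ∫ t d⟨x, E(t) x⟩` on it. -/
def IsSpectralMeasureOf (E : PVM H) (G : H →ₗ.[ℂ] H) : Prop :=
  (∀ x, x ∈ G.domain ↔ ∫⁻ t, ENNReal.ofReal (t ^ 2) ∂E.measure x < ⊤) ∧
    ∀ x : G.domain, ⟪(x : H), G x⟫_ℂ = ((∫ t, t ∂E.measure (x : H) : ℝ) : ℂ)

/-- `Tr e^{-βG} = ∑ᵢ ⟨eᵢ, e^{-βG} eᵢ⟩ ∈ [0, ∞]`, where `G` is the operator with spectral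
measure `E`, so that `⟨x, e^{-βG} x⟩ = ∫ e^{-βt} d⟨x, E(t) x⟩`. -/
noncomputable def traceExp (E : PVM H) (β : ℝ) : ℝ≥0∞ :=
  ∑' i, ∫⁻ t, ENNReal.ofReal (Real.exp (-β * t)) ∂E.measure (stdBasis H i)

/-- `Tr G ρ = supₙ Tr Pₙ G ρ ∈ [0, ∞]`, where `G` is the positive operator with spectral
measure `E` and `Pₙ = E([0, n])`. The trace is computed in the basis of eigenvectors `φᵢ` of `ρ`:
`⟨φᵢ, Pₙ G ρ φᵢ⟩ = λᵢ ⟨φᵢ, Pₙ G φᵢ⟩ = λᵢ ∫_{[0, n]} t d⟨φᵢ, E(t) φᵢ⟩`. -/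
noncomputable def energy (E : PVM H) (ρ : State H) : ℝ≥0∞ :=
  ⨆ n : ℕ, ∑' i, ENNReal.ofReal (ρ.eigenvalue i) *
    ∫⁻ t in Icc (0 : ℝ) n, ENNReal.ofReal t ∂E.measure (ρ.basis i)

end PVM

/-- A positive operator on `H`, possibly unbounded: a self-adjoint (in particular densely defined)
operator `G` with `⟨x, G x⟩ ≥ 0` for all `x` in its domain. -/
def IsPositiveOperator (G : H →ₗ.[ℂ] H) : Prop :=
  IsSelfAdjoint G ∧ ∀ x : G.domain, 0 ≤ RCLike.re ⟪(x : H), G x⟫_ℂ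

end QState

/-! The limit conditions on `β` say that a partition function is `exp (o (1 / β))` as `β → 0⁺`: the
upper bound is `SubExp`, and the matching lower bound comes from a single term of the sum. Such
functions are closed under sums, products, constant factors and `β ↦ β / 2`, so the estimates may
lose constants, square the partition function, or add the levels `log (i + 1) ^ 3`, which are
harmless by `subExp_log_rpow`. The last lemma also settles the sufficient condition with `q > 2`.

From the FA-property, everything is built diagonally in an eigenbasis of `ρ`. An operator has
eigenvalues `g` on the positive eigenvectors and the levels `log (i + 1) ^ 3` on the kernel, which
carries no energy. A reference state has eigenvalues `exp (-g) / Z` on the positive eigenvectors and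
zero elsewhere; comparison with it also bounds the entropy.

Both converses reduce to `State.faProperty_of_measures`. The observable is `G` or `-log σ`, and `ν
i` is its distribution in the `i`-th eigenvector of `ρ`. The number of levels below `n + 1` is `N n
= ∑ i, ν i (Iio (n + 1))`, and `g m` is essentially the integer part of the `m`-th level. Ky Fan's
principle (`tsum_eigenvalueSeq_tail_le`) shows that pairing the ordered eigenvalues of `ρ` with the
ordered levels costs no more than the mean energy. The Chernoff bound on `N n` by the partition
function keeps the partition function of `g` subexponential. For `-log σ`, finite entropy is what
turns finite relative entropy into finite mean energy. -/

namespace QState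

/-! ### Functions of subexponential growth in `1 / β` -/

/-- `S β = exp (o (1 / β))` as `β → 0⁺`, as an upper bound. -/
def SubExp (S : ℝ → ℝ≥0∞) : Prop :=
  ∀ ε > 0, ∀ᶠ β in 𝓝[>] (0 : ℝ), S β ≤ ENNReal.ofReal (Real.exp (ε / β))

theorem eventually_pos_nhdsGT : ∀ᶠ β in 𝓝[>] (0 : ℝ), 0 < β := self_mem_nhdsWithin

theorem eventually_le_exp_div (C : ℝ) {ε : ℝ} (hε : 0 < ε) :
    ∀ᶠ β in 𝓝[>] (0 : ℝ), C ≤ Real.exp (ε / β) := by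
  have h : Tendsto (fun β : ℝ => Real.exp (ε / β)) (𝓝[>] 0) atTop := by
    refine Real.tendsto_exp_atTop.comp ?_
    exact (tendsto_inv_nhdsGT_zero.const_mul_atTop hε).congr fun β => (div_eq_mul_inv ε β).symm
  exact h.eventually_ge_atTop C

namespace SubExp

theorem mono {S T : ℝ → ℝ≥0∞} (hT : SubExp T) (h : ∀ᶠ β in 𝓝[>] (0 : ℝ), S β ≤ T β) :
    SubExp S := fun ε hε => by
  filter_upwards [hT ε hε, h] with β h1 h2 using h2.trans h1

theorem mul {S T : ℝ → ℝ≥0∞} (hS : SubExp S) (hT : SubExp T) : SubExp (fun β => S β * T β) :=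
  fun ε hε => by
  filter_upwards [hS (ε / 2) (by positivity), hT (ε / 2) (by positivity)] with β h1 h2
  refine (mul_le_mul' h1 h2).trans_eq ?_
  rw [← ENNReal.ofReal_mul (by positivity), ← Real.exp_add]
  congr 2
  ring

theorem const {C : ℝ≥0∞} (hC : C ≠ ⊤) : SubExp (fun _ => C) := fun ε hε => by
  filter_upwards [eventually_le_exp_div C.toReal hε] with β h
  rw [← ENNReal.ofReal_toReal hC]
  exact ENNReal.ofReal_le_ofReal h

theorem add {S T : ℝ → ℝ≥0∞} (hS : SubExp S) (hT : SubExp T) : SubExp (fun β => S β + T β) :=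
  fun ε hε => by
  filter_upwards [hS (ε / 2) (by positivity), hT (ε / 2) (by positivity),
    const (C := 2) (by simp) (ε / 2) (by positivity)] with β h1 h2 h3
  refine (add_le_add h1 h2).trans ?_
  rw [← two_mul]
  refine (mul_le_mul_left h3 _).trans_eq ?_
  rw [← ENNReal.ofReal_mul (by positivity), ← Real.exp_add]
  congr 2
  ring

theorem comp_half {S : ℝ → ℝ≥0∞} (hS : SubExp S) : SubExp (fun β => S (β / 2)) := fun ε hε => by
  have ht : Tendsto (fun β : ℝ => β / 2) (𝓝[>] 0) (𝓝[>] 0) := by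
    refine tendsto_nhdsWithin_iff.2 ⟨?_, ?_⟩
    · exact tendsto_nhdsWithin_of_tendsto_nhds (Continuous.tendsto' (by fun_prop) _ _ (by simp))
    · filter_upwards [eventually_pos_nhdsGT] with β hβ
      exact half_pos hβ
  filter_upwards [ht.eventually (hS (ε / 2) (by positivity)), eventually_pos_nhdsGT] with β h hβ
  refine h.trans_eq ?_
  congr 2
  field_simp

/-- Raising `S β ^ β ≤ exp ε` to the power `1 / β` gives the bound. -/
theorem of_tendsto {S : ℝ → ℝ≥0∞} (h : Tendsto (fun β => S β ^ β) (𝓝[>] 0) (𝓝 1)) :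
    SubExp S := fun ε hε => by
  have h1 : (1 : ℝ≥0∞) < ENNReal.ofReal (Real.exp ε) := by
    rw [ENNReal.one_lt_ofReal]
    simpa using hε
  filter_upwards [h.eventually_lt_const h1, eventually_pos_nhdsGT] with β h2 hβ
  have h3 := ENNReal.rpow_le_rpow h2.le (inv_pos.2 hβ).le
  rw [← ENNReal.rpow_mul, mul_inv_cancel₀ hβ.ne', ENNReal.rpow_one,
    ENNReal.ofReal_rpow_of_pos (Real.exp_pos _), ← Real.exp_mul, ← div_eq_mul_inv] at h3
  exact h3

/-- Subexponential growth bounds `S β ^ β` above by `exp ε`, and the lower bound becomes `exp (-β ^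
2 * C) → 1`. In the applications `C` is one energy level, so that the lower bound is one term of the
sum. -/
theorem tendsto_rpow {S : ℝ → ℝ≥0∞} (hS : SubExp S) {C : ℝ}
    (hC : ∀ᶠ β in 𝓝[>] (0 : ℝ), ENNReal.ofReal (Real.exp (-β * C)) ≤ S β) :
    Tendsto (fun β => S β ^ β) (𝓝[>] 0) (𝓝 1) := by
  refine tendsto_order.2 ⟨fun a ha => ?_, fun a ha => ?_⟩
  · have hl : Tendsto (fun β : ℝ => ENNReal.ofReal (Real.exp (-β * C * β))) (𝓝[>] 0) (𝓝 1) := by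
      refine tendsto_nhdsWithin_of_tendsto_nhds ?_
      refine Continuous.tendsto' ?_ _ _ (by simp)
      exact ENNReal.continuous_ofReal.comp (by fun_prop)
    filter_upwards [hl.eventually_const_lt ha, hC, eventually_pos_nhdsGT] with β h1 h2 hβ
    refine h1.trans_le ?_
    rw [Real.exp_mul, ← ENNReal.ofReal_rpow_of_pos (Real.exp_pos _)]
    exact ENNReal.rpow_le_rpow h2 hβ.le
  · obtain ⟨ε, hε, hεa⟩ : ∃ ε : ℝ, 0 < ε ∧ ENNReal.ofReal (Real.exp ε) < a := by
      have hl : Tendsto (fun ε : ℝ => ENNReal.ofReal (Real.exp ε)) (𝓝[>] 0) (𝓝 1) := by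
        refine tendsto_nhdsWithin_of_tendsto_nhds ?_
        refine Continuous.tendsto' ?_ _ _ (by simp)
        exact ENNReal.continuous_ofReal.comp (by fun_prop)
      exact (eventually_pos_nhdsGT.and (hl.eventually_lt_const ha)).exists
    filter_upwards [hS ε hε, eventually_pos_nhdsGT] with β h1 hβ
    refine (ENNReal.rpow_le_rpow h1 hβ.le).trans_lt ?_
    rw [ENNReal.ofReal_rpow_of_pos (Real.exp_pos _), ← Real.exp_mul, div_mul_cancel₀ _ hβ.ne']
    exact hεa

theorem eventually_lt_top {S : ℝ → ℝ≥0∞} (hS : SubExp S) : ∀ᶠ β in 𝓝[>] (0 : ℝ), S β < ⊤ := by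
  filter_upwards [hS 1 one_pos] with β h using h.trans_lt ENNReal.ofReal_lt_top

end SubExp

/-! ### Partition functions of powers of the logarithm -/

theorem summable_exp_neg_two_mul_log :
    Summable fun i : ℕ => Real.exp (-(2 * Real.log (i + 1))) := by
  have h : Summable fun i : ℕ => 1 / ((i + 1 : ℕ) : ℝ) ^ 2 :=
    (summable_nat_add_iff 1).2 (Real.summable_one_div_nat_pow.2 (by norm_num))
  refine h.congr fun i => ?_
  have hi : (0 : ℝ) < i + 1 := by positivity
  rw [Real.exp_neg, mul_comm, Real.exp_mul, Real.exp_log hi]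
  push_cast
  rw [one_div]
  norm_num

/-- With `L = log (i + 1)` and `R = (2 / β) ^ s`, one has `-β L ^ q ≤ 2 R - 2 L`, so the sum is at
most `exp (2 R)` times `∑ (i + 1) ^ (-2)`. Moreover `β R` is of order `β ^ (1 - s)`, which tends to
`0` because `q > 2` means `s < 1`. -/
theorem subExp_log_rpow {q : ℝ} (hq : 2 < q) :
    SubExp fun β => ∑' i : ℕ, ENNReal.ofReal (Real.exp (-β * Real.log (i + 1) ^ q)) := by
  -- Chosen so that `L ≥ (2 / β) ^ s` is equivalent to `β L ^ (q - 1) ≥ 2`, beyond which `β L ^ q`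
  -- dominates `2 L`.
  set s : ℝ := (q - 1)⁻¹ with hs
  have hs1 : s < 1 := inv_lt_one_of_one_lt₀ (by linarith)
  have hs0 : 0 < s := inv_pos.2 (by linarith)
  set C : ℝ≥0∞ := ∑' i : ℕ, ENNReal.ofReal (Real.exp (-(2 * Real.log (i + 1)))) with hCdef
  have hC : C ≠ ⊤ := summable_exp_neg_two_mul_log.tsum_ofReal_ne_top
  have hR : SubExp fun β => ENNReal.ofReal (Real.exp (2 * (2 / β) ^ s)) := fun ε hε => by
    have hl : Tendsto (fun β : ℝ => 2 * 2 ^ s * β ^ (1 - s)) (𝓝[>] 0) (𝓝 0) := by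
      refine tendsto_nhdsWithin_of_tendsto_nhds ?_
      have h0 : Tendsto (fun β : ℝ => β ^ (1 - s)) (𝓝 0) (𝓝 (0 ^ (1 - s))) :=
        (Real.continuousAt_rpow_const _ _ (Or.inr (by linarith))).tendsto
      rw [Real.zero_rpow (by linarith)] at h0
      simpa using h0.const_mul (2 * 2 ^ s)
    filter_upwards [hl.eventually_lt_const hε, eventually_pos_nhdsGT] with β h hβ
    refine ENNReal.ofReal_le_ofReal (Real.exp_le_exp.2 ?_)
    rw [le_div_iff₀ hβ]
    refine le_trans (le_of_eq ?_) h.le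
    rw [Real.div_rpow (by norm_num) hβ.le, Real.rpow_sub hβ, Real.rpow_one]
    field_simp
  refine (hR.mul (SubExp.const hC)).mono ?_
  filter_upwards [eventually_pos_nhdsGT] with β hβ
  rw [hCdef, ← ENNReal.tsum_mul_left]
  refine ENNReal.tsum_le_tsum fun i => ?_
  rw [← ENNReal.ofReal_mul (by positivity), ← Real.exp_add]
  refine ENNReal.ofReal_le_ofReal (Real.exp_le_exp.2 ?_)
  have hL : 0 ≤ Real.log (i + 1) := Real.log_nonneg (by linarith [i.cast_nonneg (α := ℝ)])
  set L := Real.log (i + 1)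
  rcases le_total L ((2 / β) ^ s) with h | h
  · have : 0 ≤ β * L ^ q := by positivity
    linarith
  · have hR0 : (0 : ℝ) < (2 / β) ^ s := by positivity
    have hL0 : 0 < L := hR0.trans_le h
    have h1 : 2 / β ≤ L ^ (q - 1) := by
      have := Real.rpow_le_rpow hR0.le h (show 0 ≤ q - 1 by linarith)
      rwa [← Real.rpow_mul (by positivity), hs, inv_mul_cancel₀ (by linarith), Real.rpow_one]
        at this
    have h2 : L ^ q = L ^ (q - 1) * L := by
      conv_rhs => rw [← Real.rpow_add_one hL0.ne']
      simp
    rw [div_le_iff₀ hβ] at h1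
    rw [h2]
    nlinarith [mul_le_mul_of_nonneg_right h1 hL]

end QState

namespace QState

/-! ### Hilbert bases -/

section Basis

variable {H : Type*} [NormedAddCommGroup H] [InnerProductSpace ℂ H] {ι : Type*}

theorem countable_of_hilbertBasis [TopologicalSpace.SeparableSpace H] (b : HilbertBasis ι ℂ H) :
    Countable ι := by
  refine Pairwise.countable_of_isOpen_disjoint (s := fun i => Metric.ball (b i) (1 / 2))
    (fun i j hij => ?_) (fun i => Metric.isOpen_ball)
    fun i => ⟨b i, Metric.mem_ball_self (by norm_num)⟩
  refine Metric.ball_disjoint_ball ?_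
  rw [dist_eq_norm]
  have h : ‖b i - b j‖ ^ 2 = 2 := by
    rw [@norm_sub_sq ℂ, b.orthonormal.inner_eq_zero hij, b.orthonormal.norm_eq_one,
      b.orthonormal.norm_eq_one]
    norm_num
  nlinarith [norm_nonneg (b i - b j)]

theorem hasSum_norm_inner_sq (b : HilbertBasis ι ℂ H) (x : H) :
    HasSum (fun i => ‖⟪b i, x⟫_ℂ‖ ^ 2) (‖x‖ ^ 2) := by
  have h := (b.hasSum_inner_mul_inner x x).mapL RCLike.reCLM
  simp only [RCLike.reCLM_apply, inner_self_eq_norm_sq] at h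
  refine h.congr_fun fun i => ?_
  rw [← inner_conj_symm x (b i), RCLike.conj_mul]
  norm_cast

theorem tsum_ofReal_norm_inner_sq (b : HilbertBasis ι ℂ H) (x : H) :
    ∑' i, ENNReal.ofReal (‖⟪b i, x⟫_ℂ‖ ^ 2) = ENNReal.ofReal (‖x‖ ^ 2) := by
  have h := hasSum_norm_inner_sq b x
  rw [← ENNReal.ofReal_tsum_of_nonneg (fun _ => by positivity) h.summable, h.tsum_eq]

theorem eq_of_inner_basis_eq (b : HilbertBasis ι ℂ H) {x y : H}
    (h : ∀ i, ⟪b i, x⟫_ℂ = ⟪b i, y⟫_ℂ) : x = y := by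
  refine b.repr.injective (lp.ext (funext fun i => ?_))
  rw [b.repr_apply_apply, b.repr_apply_apply, h]

theorem inner_basis_basis (b : HilbertBasis ι ℂ H) [DecidableEq ι] (i j : ι) :
    ⟪b i, b j⟫_ℂ = if i = j then 1 else 0 :=
  orthonormal_iff_ite.1 b.orthonormal i j

section Diagonal

variable {b : HilbertBasis ι ℂ H} {m : ι → ℝ} {A : H →L[ℂ] H}

theorem diagonal_basis (hA : ∀ x i, ⟪b i, A x⟫_ℂ = m i * ⟪b i, x⟫_ℂ) (i : ι) :
    A (b i) = (m i : ℂ) • b i := by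
  classical
  refine eq_of_inner_basis_eq b fun j => ?_
  rw [hA, inner_smul_right, inner_basis_basis]
  split_ifs with h
  · rw [h]
  · simp

theorem diagonal_isSymmetric (hA : ∀ x i, ⟪b i, A x⟫_ℂ = m i * ⟪b i, x⟫_ℂ) :
    (A : H →ₗ[ℂ] H).IsSymmetric := fun x y => by
  simp only [ContinuousLinearMap.coe_coe]
  refine (b.hasSum_inner_mul_inner (A x) y).unique ?_
  refine (b.hasSum_inner_mul_inner x (A y)).congr_fun fun i => ?_
  rw [hA, ← inner_conj_symm, hA, map_mul, inner_conj_symm, Complex.conj_ofReal]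
  ring

theorem hasSum_inner_diagonal {x y : H} (h : ∀ i, ⟪b i, y⟫_ℂ = m i * ⟪b i, x⟫_ℂ) :
    HasSum (fun i => ((m i * ‖⟪b i, x⟫_ℂ‖ ^ 2 : ℝ) : ℂ)) ⟪x, y⟫_ℂ := by
  refine (b.hasSum_inner_mul_inner x y).congr_fun fun i => ?_
  rw [h, ← inner_conj_symm x (b i), mul_left_comm, RCLike.conj_mul]
  push_cast
  rfl

theorem hasSum_re_inner_diagonal {x y : H} (h : ∀ i, ⟪b i, y⟫_ℂ = m i * ⟪b i, x⟫_ℂ) :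
    HasSum (fun i => m i * ‖⟪b i, x⟫_ℂ‖ ^ 2) (RCLike.re ⟪x, y⟫_ℂ) :=
  (hasSum_inner_diagonal h).mapL RCLike.reCLM

theorem diagonal_isPositive (hA : ∀ x i, ⟪b i, A x⟫_ℂ = m i * ⟪b i, x⟫_ℂ) (hm : ∀ i, 0 ≤ m i) :
    A.IsPositive := by
  refine ⟨diagonal_isSymmetric hA, fun x => ?_⟩
  rw [ContinuousLinearMap.reApplyInnerSelf_apply, inner_re_symm]
  exact (hasSum_re_inner_diagonal (hA x)).nonneg fun i => mul_nonneg (hm i) (by positivity)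

end Diagonal

/-- Coefficientwise multiplication by a bounded sequence. -/
theorem exists_diagonal (b : HilbertBasis ι ℂ H) (m : ι → ℝ) {C : ℝ} (hm : ∀ i, |m i| ≤ C) :
    ∃ A : H →L[ℂ] H, ∀ x i, ⟪b i, A x⟫_ℂ = m i * ⟪b i, x⟫_ℂ := by
  have hmem : ∀ x, Memℓp (fun i => (m i : ℂ) * b.repr x i) 2 := by
    intro x
    rw [memℓp_gen_iff (by norm_num)]
    have h := (memℓp_gen_iff (by norm_num)).1 (lp.memℓp (b.repr x))
    refine Summable.of_nonneg_of_le (fun i => by positivity) (fun i => ?_) (h.mul_left (C ^ 2))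
    have hC : |m i| ^ 2 ≤ C ^ 2 := pow_le_pow_left₀ (abs_nonneg _) (hm i) 2
    simp only [norm_mul, Complex.norm_real, Real.norm_eq_abs, ENNReal.toReal_ofNat,
      Real.rpow_ofNat, mul_pow]
    exact mul_le_mul_of_nonneg_right hC (by positivity)
  let T : H →ₗ[ℂ] H :=
    { toFun := fun x => b.repr.symm ⟨fun i => (m i : ℂ) * b.repr x i, hmem x⟩
      map_add' := fun x y => by
        rw [← map_add]
        congr 1
        refine lp.ext (funext fun i => ?_)
        simp [mul_add]
        rfl
      map_smul' := fun c x => by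
        rw [RingHom.id_apply, ← map_smul]
        congr 1
        refine lp.ext (funext fun i => ?_)
        simp [mul_left_comm] }
  have hT : ∀ x i, ⟪b i, T x⟫_ℂ = m i * ⟪b i, x⟫_ℂ := by
    intro x i
    rw [← b.repr_apply_apply, ← b.repr_apply_apply]
    simp [T]
  refine ⟨T.mkContinuous |C| fun x => ?_, hT⟩
  refine abs_le_of_sq_le_sq' ?_ (by positivity) |>.2
  rw [mul_pow, sq_abs]
  refine hasSum_le (fun i => ?_) (hasSum_norm_inner_sq b (T x))
    ((hasSum_norm_inner_sq b x).mul_left (C ^ 2))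
  have hC : |m i| ^ 2 ≤ C ^ 2 := pow_le_pow_left₀ (abs_nonneg _) (hm i) 2
  rw [hT, norm_mul, Complex.norm_real, Real.norm_eq_abs, mul_pow]
  exact mul_le_mul_of_nonneg_right hC (by positivity)

/-! ### Traces and functional calculus in a basis of eigenvectors -/

variable [CompleteSpace H]

/-- Basis independence: with `S` the square root of `A`, expand each `‖S (b i)‖ ^ 2` in the other
basis by Parseval, exchange the sums, and move `S` across the inner product. -/
theorem posTrace_eq {A : H →L[ℂ] H} (hA : A.IsPositive) (b : HilbertBasis ι ℂ H) :
    posTrace A = ∑' i, ENNReal.ofReal (RCLike.re ⟪b i, A (b i)⟫_ℂ) := by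
  have hS : (CFC.sqrt A).IsPositive :=
    (ContinuousLinearMap.nonneg_iff_isPositive _).1 (CFC.sqrt_nonneg A)
  simp only [posTrace, ← norm_sqrt_sq hA]
  conv_lhs => simp only [← tsum_ofReal_norm_inner_sq b]
  rw [ENNReal.tsum_comm]
  refine tsum_congr fun i => ?_
  rw [← tsum_ofReal_norm_inner_sq (stdBasis H)]
  refine tsum_congr fun k => ?_
  rw [← hS.inner_left_eq_inner_right, norm_inner_symm]

theorem posTrace_eq_tsum_eigenvalue {A : H →L[ℂ] H} (hA : A.IsPositive) (b : HilbertBasis ι ℂ H)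
    {m : ι → ℝ} (hm : ∀ i, A (b i) = (m i : ℂ) • b i) :
    posTrace A = ∑' i, ENNReal.ofReal (m i) := by
  rw [posTrace_eq hA b]
  refine tsum_congr fun i => ?_
  rw [hm, inner_smul_right, inner_self_eq_norm_sq_to_K, b.orthonormal.norm_eq_one]
  simp

/-- The continuous functions on the spectrum for which the formula holds form a closed set, stable
under sums and products, that contains the constants and the identity. Evaluation at `l` makes sense
because `l - A` kills `x ≠ 0`. -/
theorem cfc_apply_eigenvector {A : H →L[ℂ] H} (hA : IsSelfAdjoint A) {f : ℝ → ℝ}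
    (hf : ContinuousOn f (spectrum ℝ A)) {x : H} {l : ℝ} (hx : A x = (l : ℂ) • x) :
    cfc f A x = (f l : ℂ) • x := by
  rcases eq_or_ne x 0 with rfl | hx0
  · simp
  have hl : l ∈ spectrum ℝ A := by
    rw [spectrum.mem_iff]
    intro hu
    obtain ⟨u, hu⟩ := hu
    have h1 : (u : H →L[ℂ] H) x = 0 := by
      rw [hu]
      simp [hx, Algebra.algebraMap_eq_smul_one]
    have h2 : (↑u⁻¹ * (u : H →L[ℂ] H)) x = 0 := by
      change (↑u⁻¹ : H →L[ℂ] H) ((u : H →L[ℂ] H) x) = 0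
      rw [h1, map_zero]
    rw [u.inv_mul] at h2
    exact hx0 h2
  rw [cfc_apply f A hA hf]
  suffices h : ∀ g : C(spectrum ℝ A, ℝ), cfcHom hA g x = ((g ⟨l, hl⟩ : ℝ) : ℂ) • x from h _
  intro g
  induction g using ContinuousMap.induction_on_of_compact with
  | const r =>
    have : (ContinuousMap.const (spectrum ℝ A) r) = algebraMap ℝ _ r := rfl
    rw [this, AlgHomClass.commutes]
    simp [Algebra.algebraMap_eq_smul_one]
  | id =>
    rw [cfcHom_id hA, hx]
    rfl
  | star_id =>
    rw [map_star, cfcHom_id hA, hA.star_eq, hx]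
    simp
  | add f g hf hg => simp [hf, hg, add_smul]
  | mul f g hf hg =>
    rw [map_mul]
    change cfcHom hA f (cfcHom hA g x) = _
    rw [hg, map_smul, hf, smul_smul]
    simp [mul_comm]
  | frequently f h =>
    have hcl : IsClosed {g : C(spectrum ℝ A, ℝ) | cfcHom hA g x = ((g ⟨l, hl⟩ : ℝ) : ℂ) • x} := by
      refine isClosed_eq ?_ ?_
      · exact (ContinuousLinearMap.apply ℂ H x).continuous.comp (cfcHom_continuous hA)
      · exact (Complex.continuous_ofReal.comp (continuous_eval_const _)).smul continuous_const
    exact hcl.closure_subset (mem_closure_iff_frequently.2 h)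

theorem posTrace_rpow {A : H →L[ℂ] H} (hA : A.IsPositive) {q : ℝ} (hq : 0 < q)
    (b : HilbertBasis ι ℂ H) {m : ι → ℝ} (hm : ∀ i, A (b i) = (m i : ℂ) • b i) :
    posTrace (A ^ q) = ∑' i, ENNReal.ofReal (m i ^ q) := by
  have h0 : 0 ≤ A := (ContinuousLinearMap.nonneg_iff_isPositive _).2 hA
  refine posTrace_eq_tsum_eigenvalue
    ((ContinuousLinearMap.nonneg_iff_isPositive _).1 CFC.rpow_nonneg) b fun i => ?_
  rw [CFC.rpow_eq_cfc_real h0]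
  exact cfc_apply_eigenvector hA.isSelfAdjoint
    (Real.continuous_rpow_const hq.le).continuousOn (hm i)

end Basis

/-! ### Spectral data of states -/

namespace State

variable {H : Type*} [NormedAddCommGroup H] [InnerProductSpace ℂ H] [CompleteSpace H]

theorem eigenvalue_nonneg (ρ : State H) (i : ρ.Index) : 0 ≤ ρ.eigenvalue i := by
  have h := ρ.isPositive.re_inner_nonneg_right (ρ.basis i)
  rw [op_basis, inner_smul_right, inner_self_eq_norm_sq_to_K,
    ρ.basis.orthonormal.norm_eq_one] at h
  simpa using h

theorem tsum_eigenvalue (ρ : State H) : ∑' i, ENNReal.ofReal (ρ.eigenvalue i) = 1 := by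
  rw [← posTrace_eq_tsum_eigenvalue ρ.isPositive ρ.basis ρ.op_basis, ρ.trace_eq_one]

theorem eigenvalue_le_one (ρ : State H) (i : ρ.Index) : ρ.eigenvalue i ≤ 1 := by
  have h := ENNReal.le_tsum (f := fun i => ENNReal.ofReal (ρ.eigenvalue i)) i
  rw [tsum_eigenvalue] at h
  simpa using h

theorem summable_eigenvalue (ρ : State H) : Summable ρ.eigenvalue := by
  have h := ENNReal.summable_toReal (ρ.tsum_eigenvalue.trans_ne ENNReal.one_ne_top)
  exact h.congr fun i => ENNReal.toReal_ofReal (ρ.eigenvalue_nonneg i)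

theorem exists_eigenvalue_pos (ρ : State H) : ∃ i, 0 < ρ.eigenvalue i := by
  by_contra! h
  have := ρ.tsum_eigenvalue
  simp [fun i => ENNReal.ofReal_eq_zero.2 (h i)] at this

theorem entropy_eq_tsum (ρ : State H) :
    ρ.entropy = ∑' i, ENNReal.ofReal (Real.negMulLog (ρ.eigenvalue i)) := by
  have hsa := ρ.isPositive.isSelfAdjoint
  have hb : ∀ i, cfc Real.negMulLog ρ.op (ρ.basis i)
      = (Real.negMulLog (ρ.eigenvalue i) : ℂ) • ρ.basis i := fun i =>
    cfc_apply_eigenvector hsa Real.continuous_negMulLog.continuousOn (ρ.op_basis i)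
  have hsym : ∀ x i, ⟪ρ.basis i, cfc Real.negMulLog ρ.op x⟫_ℂ
      = Real.negMulLog (ρ.eigenvalue i) * ⟪ρ.basis i, x⟫_ℂ := fun x i => by
    have h := (ContinuousLinearMap.isSelfAdjoint_iff_isSymmetric.1
      (cfc_predicate Real.negMulLog ρ.op)) (ρ.basis i) x
    simp only [ContinuousLinearMap.coe_coe] at h
    rw [← h, hb, inner_smul_left, Complex.conj_ofReal]
  exact posTrace_eq_tsum_eigenvalue (diagonal_isPositive hsym fun i =>
    Real.negMulLog_nonneg (ρ.eigenvalue_nonneg i) (ρ.eigenvalue_le_one i)) ρ.basis hb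

end State

end QState

namespace QState

namespace State

variable {H : Type*} [NormedAddCommGroup H] [InnerProductSpace ℂ H] [CompleteSpace H]

/-! ### The ordered sequence of eigenvalues -/

theorem finite_le_eigenvalue (ρ : State H) {t : ℝ} (ht : 0 < t) :
    {i | t ≤ ρ.eigenvalue i}.Finite := by
  have h := ρ.summable_eigenvalue.tendsto_cofinite_zero.eventually_lt_const ht
  rw [eventually_cofinite] at h
  simpa using h

theorem eigenvalueSeq_antitone (ρ : State H) : Antitone ρ.eigenvalueSeq := by
  intro n m hnm
  have hsub : {t : ℝ | 0 < t ∧ (m : ℕ∞) < {i : ρ.Index | t ≤ ρ.eigenvalue i}.encard} ⊆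
      {t : ℝ | 0 < t ∧ (n : ℕ∞) < {i : ρ.Index | t ≤ ρ.eigenvalue i}.encard} :=
    fun t ht => ⟨ht.1, lt_of_le_of_lt (by exact_mod_cast hnm) ht.2⟩
  rcases eq_empty_or_nonempty
    {t : ℝ | 0 < t ∧ (m : ℕ∞) < {i : ρ.Index | t ≤ ρ.eigenvalue i}.encard} with h | h
  · rw [eigenvalueSeq, eigenvalueSeq, h, Real.sSup_empty]
    exact Real.sSup_nonneg fun t ht => ht.1.le
  · refine csSup_le_csSup ⟨1, fun t ht => ?_⟩ h hsub
    obtain ⟨i, hi⟩ := encard_pos.1 (lt_of_le_of_lt (zero_le) ht.2)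
    exact le_trans hi (ρ.eigenvalue_le_one i)

theorem eigenvalueSeq_nonneg (ρ : State H) (n : ℕ) : 0 ≤ ρ.eigenvalueSeq n :=
  Real.sSup_nonneg fun _ ht => ht.1.le

theorem exists_enumeration (ρ : State H) :
    ∃ e : ρ.Index → ℕ, InjOn e {i | 0 < ρ.eigenvalue i} ∧
      (∀ i, 0 < ρ.eigenvalue i → ρ.eigenvalueSeq (e i) = ρ.eigenvalue i) ∧
      ∀ n, (∀ i, 0 < ρ.eigenvalue i → e i ≠ n) → ρ.eigenvalueSeq n = 0 := by
  set l := ρ.eigenvalue with hl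
  have hP : {i | 0 < l i}.Countable :=
    ρ.summable_eigenvalue.countable_support.mono fun i hi => (ne_of_gt hi : l i ≠ 0)
  obtain ⟨f, hf⟩ := countable_iff_exists_injOn.1 hP
  -- `B i` consists of the indices strictly before `i` when eigenvalues decrease and ties are broken
  -- by `f`; its cardinality is the zero-based rank of `i`.
  let B : ρ.Index → Set ρ.Index := fun i => {j | l i < l j ∨ (l j = l i ∧ f j < f i)}
  have hBsub : ∀ i, B i ⊆ {j | l i ≤ l j} := fun i j hj => by
    rcases hj with h | h
    · exact h.le
    · exact h.1.ge
  have hBfin : ∀ i, 0 < l i → (B i).Finite := fun i hi =>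
    (ρ.finite_le_eigenvalue hi).subset (hBsub i)
  have hirr : ∀ i, i ∉ B i := fun i hi => by
    rcases hi with h | h
    · exact lt_irrefl _ h
    · exact lt_irrefl _ h.2
  have htrans : ∀ i j, j ∈ B i → B j ⊆ B i := by
    intro i j hj k hk
    rcases hj with h | h <;> rcases hk with h' | h'
    · exact Or.inl (h.trans h')
    · exact Or.inl (by rw [h'.1]; exact h)
    · exact Or.inl (by rw [← h.1]; exact h')
    · exact Or.inr ⟨h'.1.trans h.1, h'.2.trans h.2⟩
  have hlt : ∀ i j, 0 < l i → j ∈ B i → (B j).ncard < (B i).ncard := fun i j hi hj =>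
    ncard_lt_ncard (ssubset_of_subset_not_subset (htrans i j hj) fun h => hirr j (h hj))
      (hBfin i hi)
  have hinj : InjOn (fun i => (B i).ncard) {i | 0 < l i} := by
    intro i hi j hj hij
    by_contra hne
    have hfne : f i ≠ f j := fun h => hne (hf hi hj h)
    have htri : j ∈ B i ∨ i ∈ B j := by
      rcases lt_trichotomy (l i) (l j) with h | h | h
      · exact Or.inl (Or.inl h)
      · rcases lt_or_gt_of_ne hfne with h' | h'
        · exact Or.inr (Or.inr ⟨h, h'⟩)
        · exact Or.inl (Or.inr ⟨h.symm, h'⟩)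
      · exact Or.inr (Or.inl h)
    rcases htri with h | h
    · exact (hlt i j hi h).ne' hij
    · exact (hlt j i hj h).ne hij
  refine ⟨fun i => (B i).ncard, hinj, fun i hi => ?_, fun n hn => ?_⟩
  · have hset : {t : ℝ | 0 < t ∧ ((B i).ncard : ℕ∞) < {j | t ≤ l j}.encard} = Ioc 0 (l i) := by
      ext t
      refine and_congr_right fun ht => ⟨fun h => ?_, fun h => ?_⟩
      · by_contra hti
        have hsub : {j | t ≤ l j} ⊆ B i := fun j hj => Or.inl ((not_le.1 hti).trans_le hj)
        rw [(hBfin i hi).cast_ncard_eq] at h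
        exact h.not_ge (encard_le_encard hsub)
      · have hsub : insert i (B i) ⊆ {j | t ≤ l j} :=
          insert_subset h ((hBsub i).trans fun j hj => le_trans h hj)
        refine lt_of_lt_of_le ?_ (encard_le_encard hsub)
        rw [encard_insert_of_notMem (hirr i), ← (hBfin i hi).cast_ncard_eq]
        exact_mod_cast Nat.lt_succ_self _
    change sSup {t : ℝ | 0 < t ∧ ((B i).ncard : ℕ∞) < {j | t ≤ l j}.encard} = l i
    rw [hset, csSup_Ioc hi]
  · have hset : {t : ℝ | 0 < t ∧ (n : ℕ∞) < {j | t ≤ l j}.encard} = ∅ := by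
      rw [eq_empty_iff_forall_notMem]
      rintro t ⟨ht, hnt⟩
      have hF := ρ.finite_le_eigenvalue ht
      have hcard : n < hF.toFinset.card := by
        rw [hF.encard_eq_coe_toFinset_card] at hnt
        exact_mod_cast hnt
      -- The indices with eigenvalue at least `t` contain all predecessors of their members, so
      -- their ranks are distinct and smaller than their number. They fill an initial segment of
      -- `ℕ`, which contains `n`.
      have himg : hF.toFinset.image (fun i => (B i).ncard) = Finset.range hF.toFinset.card := by
        refine Finset.eq_of_subset_of_card_le (fun m hm => ?_) ?_
        · obtain ⟨i, hi, rfl⟩ := Finset.mem_image.1 hm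
          have hi' : t ≤ l i := by simpa using hi
          rw [Finset.mem_range, ← ncard_eq_toFinset_card _ hF]
          refine ncard_lt_ncard (ssubset_of_subset_not_subset
            ((hBsub i).trans fun j hj => le_trans hi' hj) fun h => hirr i (h hi')) hF
        · rw [Finset.card_range, Finset.card_image_of_injOn]
          refine hinj.mono fun i hi => ?_
          have hi' : t ≤ l i := by simpa using hi
          exact ht.trans_le hi'
      have hmem := Finset.mem_range.2 hcard
      rw [← himg] at hmem
      obtain ⟨i, hi, hin⟩ := Finset.mem_image.1 hmem
      have hi' : t ≤ l i := by simpa using hi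
      exact hn i (ht.trans_le hi') hin
    change sSup {t : ℝ | 0 < t ∧ (n : ℕ∞) < {j | t ≤ l j}.encard} = 0
    rw [hset, Real.sSup_empty]

/-- An enumeration of the indices of positive eigenvalues in non-increasing order. -/
noncomputable def rank (ρ : State H) : ρ.Index → ℕ := ρ.exists_enumeration.choose

theorem rank_injOn (ρ : State H) : InjOn ρ.rank {i | 0 < ρ.eigenvalue i} :=
  ρ.exists_enumeration.choose_spec.1

theorem eigenvalueSeq_rank (ρ : State H) {i : ρ.Index} (hi : 0 < ρ.eigenvalue i) :
    ρ.eigenvalueSeq (ρ.rank i) = ρ.eigenvalue i :=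
  ρ.exists_enumeration.choose_spec.2.1 i hi

theorem exists_rank_eq (ρ : State H) {n : ℕ} (hn : ρ.eigenvalueSeq n ≠ 0) :
    ∃ i, 0 < ρ.eigenvalue i ∧ ρ.rank i = n := by
  by_contra! h
  exact hn (ρ.exists_enumeration.choose_spec.2.2 n h)

/-- The ranks of positive eigenvalues miss only positions where the sequence is zero, and there `F`
vanishes. -/
theorem tsum_indicator_rank (ρ : State H) {F : ℕ → ℝ≥0∞}
    (hF : ∀ n, ρ.eigenvalueSeq n = 0 → F n = 0) :
    ∑' i, {i | 0 < ρ.eigenvalue i}.indicator (fun i => F (ρ.rank i)) i = ∑' n, F n := by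
  rw [← tsum_subtype]
  refine Function.Injective.tsum_eq (f := F)
    (g := fun i : {i | 0 < ρ.eigenvalue i} => ρ.rank i) (fun i j h => ?_) fun n hn => ?_
  · exact Subtype.ext (ρ.rank_injOn i.2 j.2 h)
  · obtain ⟨i, hi, hin⟩ := ρ.exists_rank_eq fun h => hn (hF n h)
    exact ⟨⟨i, hi⟩, hin⟩

theorem tsum_indicator_rank_le (ρ : State H) (F : ℕ → ℝ≥0∞) :
    ∑' i, {i | 0 < ρ.eigenvalue i}.indicator (fun i => F (ρ.rank i)) i ≤ ∑' n, F n := by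
  rw [← tsum_subtype]
  exact ENNReal.tsum_comp_le_tsum_of_injective (f := fun i : {i | 0 < ρ.eigenvalue i} => ρ.rank i)
    (fun i j h => Subtype.ext (ρ.rank_injOn i.2 j.2 h)) F

theorem tsum_eigenvalue_mul_rank (ρ : State H) (F : ℕ → ℝ≥0∞) :
    ∑' i, ENNReal.ofReal (ρ.eigenvalue i) * F (ρ.rank i) =
      ∑' n, ENNReal.ofReal (ρ.eigenvalueSeq n) * F n := by
  rw [← ρ.tsum_indicator_rank (F := fun n => ENNReal.ofReal (ρ.eigenvalueSeq n) * F n)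
    (fun n hn => by simp [hn])]
  refine tsum_congr fun i => ?_
  by_cases hi : 0 < ρ.eigenvalue i
  · rw [indicator_of_mem (by exact hi), ρ.eigenvalueSeq_rank hi]
  · rw [indicator_of_notMem (by exact hi), ENNReal.ofReal_eq_zero.2 (not_lt.1 hi), zero_mul]

/-- The tail of the sequence of eigenvalues is at most `Tr (1 - A) ρ` if `0 ≤ A ≤ 1` has trace at
most `k`; `c` and `d` are the diagonal elements of `A` and `1 - A` in an eigenbasis of `ρ`. -/
theorem tsum_eigenvalueSeq_tail_le (ρ : State H) {c d : ρ.Index → ℝ≥0∞}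
    (hcd : ∀ i, 0 < ρ.eigenvalue i → c i + d i = 1) {k : ℕ} (hk : ∑' i, c i ≤ k) :
    ∑' n, ENNReal.ofReal (ρ.eigenvalueSeq n) * (Ici k).indicator 1 n ≤
      ∑' i, ENNReal.ofReal (ρ.eigenvalue i) * d i := by
  set P := {i | 0 < ρ.eigenvalue i} with hPdef
  set T := P ∩ {i | k ≤ ρ.rank i} with hT
  set U := P ∩ {i | ρ.rank i < k} with hU
  set t := ENNReal.ofReal (ρ.eigenvalueSeq k) with ht
  -- The exchange behind Ky Fan's principle. If `λ_k ≠ 0`, exactly `k` indices have rank below `k`,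
  -- so `∑ c ≤ k` is the sum of `c + d` over `U`. Cancelling the finite sum of `c` over `U` bounds
  -- the mass of `c` on `T` by the deficit `d` on `U`.
  have hmove : t * ∑' i, T.indicator c i ≤ t * ∑' i, U.indicator d i := by
    rcases eq_or_ne (ρ.eigenvalueSeq k) 0 with h0 | h0
    · simp [ht, h0]
    refine mul_le_mul_right ?_ t
    have hfin : ∑' i, U.indicator c i ≠ ⊤ := by
      refine ne_top_of_le_ne_top (ENNReal.natCast_ne_top k) (le_trans ?_ hk)
      exact ENNReal.tsum_le_tsum fun i => indicator_le_self' (fun _ _ => zero_le) i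
    refine (ENNReal.add_le_add_iff_left hfin).1 ?_
    rw [← ENNReal.tsum_add, ← ENNReal.tsum_add]
    calc ∑' i, (U.indicator c i + T.indicator c i) ≤ ∑' i, c i := by
          refine ENNReal.tsum_le_tsum fun i => ?_
          by_cases h : ρ.rank i < k
          · have hiT : i ∉ T := fun hi => absurd h (not_lt.2 hi.2)
            rw [indicator_of_notMem hiT, add_zero]
            exact indicator_le_self' (fun _ _ => zero_le) i
          · have hiU : i ∉ U := fun hi => h hi.2
            rw [indicator_of_notMem hiU, zero_add]
            exact indicator_le_self' (fun _ _ => zero_le) i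
      _ ≤ k := hk
      _ = ∑' n, (Iio k).indicator (1 : ℕ → ℝ≥0∞) n := by
          rw [← tsum_subtype]
          simp
      _ = ∑' i, P.indicator (fun i => (Iio k).indicator (1 : ℕ → ℝ≥0∞) (ρ.rank i)) i := by
          refine (ρ.tsum_indicator_rank fun n hn => indicator_of_notMem (fun hnk => h0 ?_) _).symm
          have hkn := ρ.eigenvalueSeq_antitone (le_of_lt hnk)
          rw [hn] at hkn
          exact le_antisymm hkn (ρ.eigenvalueSeq_nonneg k)
      _ ≤ ∑' i, (U.indicator c i + U.indicator d i) := by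
          refine ENNReal.tsum_le_tsum fun i => ?_
          by_cases hi : i ∈ U
          · rw [indicator_of_mem hi, indicator_of_mem hi, hcd i hi.1, indicator_of_mem hi.1,
              indicator_of_mem (by exact hi.2)]
            rfl
          · refine le_of_eq_of_le ?_ (zero_le)
            by_cases hiP : i ∈ P
            · rw [indicator_of_mem hiP, indicator_of_notMem (s := Iio k) fun h => hi ⟨hiP, h⟩]
            · rw [indicator_of_notMem hiP]
  rw [← ρ.tsum_eigenvalue_mul_rank]
  -- Eigenvalues are at most `t` on `T` and at least `t` on `U`, so the mass of `c` on `T`, priced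
  -- at `t`, is paid for by `d` on `U`.
  calc ∑' i, ENNReal.ofReal (ρ.eigenvalue i) * (Ici k).indicator 1 (ρ.rank i)
      ≤ ∑' i, (T.indicator (fun i => ENNReal.ofReal (ρ.eigenvalue i) * d i) i
          + t * T.indicator c i) := by
        refine ENNReal.tsum_le_tsum fun i => ?_
        by_cases hi : i ∈ T
        · rw [indicator_of_mem hi, indicator_of_mem hi, indicator_of_mem (by exact hi.2),
            Pi.one_apply, ← hcd i hi.1, mul_add,
            add_comm (_ * c i)]
          gcongr
          rw [ht, ← ρ.eigenvalueSeq_rank hi.1]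
          exact ENNReal.ofReal_le_ofReal (ρ.eigenvalueSeq_antitone hi.2)
        · refine le_of_eq_of_le ?_ (zero_le)
          by_cases hiP : i ∈ P
          · rw [indicator_of_notMem (s := Ici k) (fun h => hi ⟨hiP, h⟩), mul_zero]
          · rw [ENNReal.ofReal_eq_zero.2 (not_lt.1 hiP), zero_mul]
    _ = ∑' i, T.indicator (fun i => ENNReal.ofReal (ρ.eigenvalue i) * d i) i
          + t * ∑' i, T.indicator c i := by
        rw [ENNReal.tsum_add, ENNReal.tsum_mul_left]
    _ ≤ ∑' i, T.indicator (fun i => ENNReal.ofReal (ρ.eigenvalue i) * d i) i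
          + t * ∑' i, U.indicator d i := by gcongr
    _ = ∑' i, (T.indicator (fun i => ENNReal.ofReal (ρ.eigenvalue i) * d i) i
          + t * U.indicator d i) := by
        rw [ENNReal.tsum_add, ENNReal.tsum_mul_left]
    _ ≤ ∑' i, ENNReal.ofReal (ρ.eigenvalue i) * d i := by
        refine ENNReal.tsum_le_tsum fun i => ?_
        by_cases hi : i ∈ U
        · have hiT : i ∉ T := fun h => not_lt_of_ge (show k ≤ ρ.rank i from h.2) (show ρ.rank i < k from hi.2)
          rw [indicator_of_notMem hiT, indicator_of_mem hi, zero_add]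
          gcongr
          rw [ht, ← ρ.eigenvalueSeq_rank hi.1]
          exact ENNReal.ofReal_le_ofReal (ρ.eigenvalueSeq_antitone (le_of_lt hi.2))
        · rw [indicator_of_notMem hi, mul_zero, add_zero]
          exact indicator_le_self' (fun _ _ => zero_le) i

end State

end QState

/-! ### Counting energy levels -/

namespace QState

/-- The left side counts the positive integers up to `t`, which makes it the natural floor of `t`.
-/
theorem tsum_indicator_Ici_le (t : ℝ) :
    ∑' n : ℕ, (Ici ((n : ℝ) + 1)).indicator (1 : ℝ → ℝ≥0∞) t ≤ ENNReal.ofReal t := by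
  rw [tsum_eq_sum (s := Finset.range ⌊t⌋₊)]
  · calc ∑ n ∈ Finset.range ⌊t⌋₊, (Ici ((n : ℝ) + 1)).indicator (1 : ℝ → ℝ≥0∞) t
        ≤ ∑ n ∈ Finset.range ⌊t⌋₊, 1 :=
          Finset.sum_le_sum fun n _ => indicator_le_self' (fun _ _ => zero_le) t
      _ = ENNReal.ofReal (⌊t⌋₊ : ℝ) := by simp
      _ ≤ ENNReal.ofReal t := by
          rcases le_total 0 t with h | h
          · exact ENNReal.ofReal_le_ofReal (Nat.floor_le h)
          · simp [Nat.floor_of_nonpos h]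
  · intro n hn
    refine indicator_of_notMem (fun h => hn (Finset.mem_range.2 ?_)) _
    have h' : ((n + 1 : ℕ) : ℝ) ≤ t := by exact_mod_cast h
    exact Nat.le_floor h'

theorem tsum_measure_Ici_le (ν : Measure ℝ) :
    ∑' n : ℕ, ν (Ici ((n : ℝ) + 1)) ≤ ∫⁻ t, ENNReal.ofReal t ∂ν := by
  calc ∑' n : ℕ, ν (Ici ((n : ℝ) + 1))
      = ∑' n : ℕ, ∫⁻ t, (Ici ((n : ℝ) + 1)).indicator 1 t ∂ν :=
        tsum_congr fun n => (lintegral_indicator_one measurableSet_Ici).symm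
    _ = ∫⁻ t, ∑' n : ℕ, (Ici ((n : ℝ) + 1)).indicator 1 t ∂ν :=
        (lintegral_tsum fun n => (measurable_one.indicator measurableSet_Ici).aemeasurable).symm
    _ ≤ _ := lintegral_mono tsum_indicator_Ici_le

/-- Chernoff's bound: `1 ≤ exp (b * (s - t))` for `t < s`. -/
theorem measure_Iio_le_exp_mul (ν : Measure ℝ) {b : ℝ} (hb : 0 ≤ b) (s : ℝ) :
    ν (Iio s) ≤ ENNReal.ofReal (Real.exp (b * s)) *
      ∫⁻ t, ENNReal.ofReal (Real.exp (-b * t)) ∂ν := by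
  rw [← lintegral_const_mul _ (by fun_prop), ← lintegral_indicator_one measurableSet_Iio]
  refine lintegral_mono fun t => ?_
  by_cases ht : t ∈ Iio s
  swap
  · rw [indicator_of_notMem ht]
    exact zero_le
  rw [indicator_of_mem ht]
  rw [← ENNReal.ofReal_mul (by positivity), ← Real.exp_add, Pi.one_apply, ENNReal.one_le_ofReal,
    Real.one_le_exp_iff]
  nlinarith [mul_nonneg hb (sub_nonneg.2 (le_of_lt (mem_Iio.1 ht)))]

theorem tsum_inv_sq_ne_top : ∑' m : ℕ, ((m + 1 : ℝ≥0∞)⁻¹) ^ 2 ≠ ⊤ := by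
  have h : Summable fun i : ℕ => 1 / ((i + 1 : ℕ) : ℝ) ^ 2 :=
    (summable_nat_add_iff 1).2 (Real.summable_one_div_nat_pow.2 (by norm_num))
  convert h.tsum_ofReal_ne_top using 3 with m
  rw [one_div, ENNReal.ofReal_inv_of_pos (by positivity), ENNReal.ofReal_pow (by positivity),
    ENNReal.ofReal_natCast, ENNReal.inv_pow]
  push_cast
  rfl

namespace State

variable {H : Type*} [NormedAddCommGroup H] [InnerProductSpace ℂ H] [CompleteSpace H]

theorem faProperty_of_subExp (ρ : State H) {g : ℕ → ℝ} (hg : ∀ i, 0 ≤ g i)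
    (h : (∑' i, ENNReal.ofReal (ρ.eigenvalueSeq i * g i)) < ⊤)
    (hS : SubExp fun β => ∑' i, ENNReal.ofReal (Real.exp (-β * g i))) : ρ.FAProperty :=
  ⟨g, hg, h, hS.tendsto_rpow (C := g 0) (Eventually.of_forall fun β =>
    ENNReal.le_tsum (f := fun i => ENNReal.ofReal (Real.exp (-β * g i))) 0)⟩

/-- If the numbers of eigenvalues of an observable below `1, 2, …` are bounded by `N 0, N 1, …`,
then the trace of its product with `ρ` is at least `∑ₙ ∑ {λₘ | m ≥ N n}`. -/
theorem tsum_eigenvalueSeq_mul_count_le (ρ : State H) {ν : ρ.Index → Measure ℝ}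
    (hν : ∀ i, 0 < ρ.eigenvalue i → ν i univ = 1) :
    ∑' m : ℕ, ENNReal.ofReal (ρ.eigenvalueSeq m) *
        ∑' n : ℕ, {m : ℕ | ∑' i, ν i (Iio ((n : ℝ) + 1)) ≤ m}.indicator (1 : ℕ → ℝ≥0∞) m ≤
      ∑' i, ENNReal.ofReal (ρ.eigenvalue i) * ∫⁻ t, ENNReal.ofReal t ∂ν i := by
  simp only [← ENNReal.tsum_mul_left]
  rw [ENNReal.tsum_comm]
  calc _ ≤ ∑' n : ℕ, ∑' i, ENNReal.ofReal (ρ.eigenvalue i) * ν i (Ici ((n : ℝ) + 1)) := by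
        refine ENNReal.tsum_le_tsum fun n => ?_
        -- If the count is finite, the tail inequality applies with `k` its ceiling. If it is
        -- infinite, no `m` reaches it and the left side is zero.
        by_cases hex : ∃ k : ℕ, ∑' i, ν i (Iio ((n : ℝ) + 1)) ≤ k
        · classical
          have hset : {m : ℕ | ∑' i, ν i (Iio ((n : ℝ) + 1)) ≤ m} = Ici (Nat.find hex) := by
            ext m
            refine ⟨fun h => Nat.find_min' hex h, fun h => (Nat.find_spec hex).trans ?_⟩
            exact_mod_cast h
          rw [hset]
          refine ρ.tsum_eigenvalueSeq_tail_le (fun i hi => ?_) (Nat.find_spec hex)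
          rw [← compl_Iio, measure_add_measure_compl measurableSet_Iio, hν i hi]
        · push Not at hex
          refine le_of_eq_of_le ?_ zero_le
          refine ENNReal.tsum_eq_zero.2 fun m => ?_
          rw [indicator_of_notMem (s := {m : ℕ | ∑' i, ν i (Iio ((n : ℝ) + 1)) ≤ m})
            (fun h => (hex m).not_ge h), mul_zero]
    _ = ∑' i, ENNReal.ofReal (ρ.eigenvalue i) * ∑' n : ℕ, ν i (Ici ((n : ℝ) + 1)) := by
        rw [ENNReal.tsum_comm]
        simp only [ENNReal.tsum_mul_left]
    _ ≤ _ := ENNReal.tsum_le_tsum fun i => by gcongr; exact tsum_measure_Ici_le _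

/-- `ν i` is the distribution, in the `i`-th eigenvector of `ρ`, of an observable of finite mean
energy and of subexponential partition function. -/
theorem faProperty_of_measures (ρ : State H) {ν : ρ.Index → Measure ℝ}
    (hν : ∀ i, 0 < ρ.eigenvalue i → ν i univ = 1)
    (hE : ∑' i, ENNReal.ofReal (ρ.eigenvalue i) * ∫⁻ t, ENNReal.ofReal t ∂ν i < ⊤)
    (hS : SubExp fun β => ∑' i, ∫⁻ t, ENNReal.ofReal (Real.exp (-β * t)) ∂ν i) :
    ρ.FAProperty := by
  classical
  set N : ℕ → ℝ≥0∞ := fun n => ∑' i, ν i (Iio ((n : ℝ) + 1)) with hN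
  set S : ℝ → ℝ≥0∞ := fun β => ∑' i, ∫⁻ t, ENNReal.ofReal (Real.exp (-β * t)) ∂ν i with hSdef
  set M : ℕ → ℝ≥0∞ := fun m => ∑' n : ℕ, {m : ℕ | N n ≤ m}.indicator (1 : ℕ → ℝ≥0∞) m with hMdef
  have hM : ∑' m : ℕ, ENNReal.ofReal (ρ.eigenvalueSeq m) * M m < ⊤ :=
    (ρ.tsum_eigenvalueSeq_mul_count_le hν).trans_lt hE
  -- The integer part of the `m`-th level, counted from zero with multiplicity. If there are at most
  -- `m` levels in all, then `M m = ⊤` forces `λ_m = 0`, so the value is free as far as the energy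
  -- is concerned; it only has to grow fast enough, and any power of the logarithm above `2` would
  -- do.
  let g : ℕ → ℝ := fun m =>
    if h : ∃ n : ℕ, (m : ℝ≥0∞) < N n then (Nat.find h : ℝ) else Real.log (m + 1) ^ (3 : ℝ)
  have hlog : ∀ m : ℕ, 0 ≤ Real.log ((m : ℝ) + 1) := fun m =>
    Real.log_nonneg (by linarith [m.cast_nonneg (α := ℝ)])
  refine ρ.faProperty_of_subExp (g := g) (fun m => ?_) ?_ ?_
  · simp only [g]
    split_ifs
    · positivity
    · exact Real.rpow_nonneg (hlog m) _
  · refine lt_of_le_of_lt (ENNReal.tsum_le_tsum fun m => ?_) hM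
    rw [ENNReal.ofReal_mul (ρ.eigenvalueSeq_nonneg m)]
    by_cases h : ∃ n : ℕ, (m : ℝ≥0∞) < N n
    · simp only [g, dif_pos h, ENNReal.ofReal_natCast]
      gcongr
      -- Each `n` below the least one with `m < N n` contributes `1` to `M m`.
      calc (Nat.find h : ℝ≥0∞)
          = ∑ n ∈ Finset.range (Nat.find h), {m : ℕ | N n ≤ m}.indicator (1 : ℕ → ℝ≥0∞) m := by
            rw [Finset.sum_congr rfl fun n hn => indicator_of_mem
              (show m ∈ {m : ℕ | N n ≤ m} from
                not_lt.1 (Nat.find_min h (Finset.mem_range.1 hn))) _]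
            simp
        _ ≤ M m := ENNReal.sum_le_tsum _
    · push Not at h
      have hMm : M m = ⊤ := by
        have h1 : M m = ∑' n : ℕ, (1 : ℝ≥0∞) :=
          tsum_congr fun n => indicator_of_mem (show m ∈ {m : ℕ | N n ≤ m} from h n) _
        rw [h1, ENNReal.tsum_const_eq_top_of_ne_zero one_ne_zero]
      have hlt := lt_of_le_of_lt (ENNReal.le_tsum (f := fun m =>
        ENNReal.ofReal (ρ.eigenvalueSeq m) * M m) m) hM
      simp only [hMm] at hlt
      have h0 : ENNReal.ofReal (ρ.eigenvalueSeq m) = 0 := by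
        by_contra hne
        exact hlt.ne (ENNReal.mul_top hne)
      rw [h0, zero_mul, zero_mul]
  · set Y : ℝ → ℝ≥0∞ := fun β => ENNReal.ofReal (Real.exp 1) * (S (β / 2) + 1) with hY
    have hYs : SubExp Y := (SubExp.const ENNReal.ofReal_ne_top).mul
      (hS.comp_half.add (SubExp.const ENNReal.one_ne_top))
    refine (((hYs.mul hYs).mul (SubExp.const tsum_inv_sq_ne_top)).add
      (subExp_log_rpow (q := 3) (by norm_num))).mono ?_
    filter_upwards [eventually_pos_nhdsGT,
      Filter.Eventually.filter_mono nhdsWithin_le_nhds (eventually_lt_nhds (zero_lt_two' ℝ))]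
      with β hβ hβ2
    rw [← ENNReal.tsum_mul_left, ← ENNReal.tsum_add]
    refine ENNReal.tsum_le_tsum fun m => ?_
    by_cases h : ∃ n : ℕ, (m : ℝ≥0∞) < N n
    · refine le_add_right ?_
      simp only [g, dif_pos h]
      set k := Nat.find h
      have hk : (m : ℝ≥0∞) < N k := Nat.find_spec h
      set b := β / 2 with hb
      have hb0 : 0 ≤ b := by positivity
      have hNk : N k ≤ ENNReal.ofReal (Real.exp (b * (k + 1))) * S b := by
        simp only [hN, hSdef, ← ENNReal.tsum_mul_left]
        exact ENNReal.tsum_le_tsum fun i => measure_Iio_le_exp_mul _ hb0 _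
      have h1 : (1 : ℝ≥0∞) ≤ ENNReal.ofReal (Real.exp (b * (k + 1))) := by
        rw [ENNReal.one_le_ofReal, Real.one_le_exp_iff]
        positivity
      have hm1 : (m + 1 : ℝ≥0∞) ≤ ENNReal.ofReal (Real.exp (b * (k + 1))) * (S b + 1) := by
        rw [mul_add, mul_one]
        exact add_le_add (hk.le.trans hNk) h1
      have hle : ENNReal.ofReal (Real.exp (-b * k)) ≤ Y β * (m + 1 : ℝ≥0∞)⁻¹ := by
        rw [← div_eq_mul_inv, ENNReal.le_div_iff_mul_le (Or.inl (by simp))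
          (Or.inl (by finiteness))]
        refine (mul_le_mul_right hm1 _).trans ?_
        rw [← mul_assoc, ← ENNReal.ofReal_mul (by positivity), ← Real.exp_add, hY]
        refine mul_le_mul_left (ENNReal.ofReal_le_ofReal (Real.exp_le_exp.2 ?_)) _
        linarith
      calc ENNReal.ofReal (Real.exp (-β * k)) = ENNReal.ofReal (Real.exp (-b * k)) ^ 2 := by
            rw [← ENNReal.ofReal_pow (by positivity), ← Real.exp_nat_mul]
            congr 2
            rw [hb]
            push_cast
            ring
        _ ≤ (Y β * (m + 1 : ℝ≥0∞)⁻¹) ^ 2 := by gcongr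
        _ = _ := by ring
    · refine le_add_left ?_
      simp only [g, dif_neg h, le_refl]

end State

end QState

/-! ### From operators and relative entropy to the FA-property -/

namespace QState

variable {H : Type*} [NormedAddCommGroup H] [InnerProductSpace ℂ H] [CompleteSpace H]

namespace PVM

theorem measure_apply (E : PVM H) (x : H) {s : Set ℝ} (hs : MeasurableSet s) :
    E.measure x s = ENNReal.ofReal (RCLike.re ⟪x, E.proj s x⟫_ℂ) :=
  Measure.ofMeasurable_apply s hs

/-- On each measurable set the total mass is the trace of a spectral projection, which does not
depend on the basis. -/
theorem sum_measure_eq (E : PVM H) {ι : Type*} (b : HilbertBasis ι ℂ H) :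
    Measure.sum (fun i => E.measure (b i)) = Measure.sum fun i => E.measure (stdBasis H i) := by
  ext s hs
  have hpos : (E.proj s).IsPositive :=
    (ContinuousLinearMap.nonneg_iff_isPositive _).1 (E.isStarProjection s hs).nonneg
  simp only [Measure.sum_apply _ hs, measure_apply _ _ hs]
  rw [← posTrace_eq hpos b, posTrace]

theorem traceExp_eq (E : PVM H) {ι : Type*} (b : HilbertBasis ι ℂ H) (β : ℝ) :
    E.traceExp β = ∑' i, ∫⁻ t, ENNReal.ofReal (Real.exp (-β * t)) ∂E.measure (b i) := by
  rw [traceExp, ← lintegral_sum_measure, ← E.sum_measure_eq b, lintegral_sum_measure]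

theorem iSup_setLIntegral_Icc (ν : Measure ℝ) :
    ⨆ n : ℕ, ∫⁻ t in Icc (0 : ℝ) n, ENNReal.ofReal t ∂ν = ∫⁻ t, ENNReal.ofReal t ∂ν := by
  have hpt : ∀ t : ℝ, ⨆ n : ℕ, (Icc (0 : ℝ) n).indicator ENNReal.ofReal t = ENNReal.ofReal t := by
    intro t
    refine le_antisymm (iSup_le fun n => indicator_le_self' (fun _ _ => zero_le) t) ?_
    rcases le_total 0 t with h | h
    · obtain ⟨n, hn⟩ := exists_nat_ge t
      refine le_iSup_of_le n ?_
      rw [indicator_of_mem (mem_Icc.2 ⟨h, hn⟩)]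
    · rw [ENNReal.ofReal_eq_zero.2 h]
      exact zero_le
  simp only [← lintegral_indicator measurableSet_Icc]
  rw [← lintegral_iSup]
  · exact lintegral_congr hpt
  · exact fun n => ENNReal.measurable_ofReal.indicator measurableSet_Icc
  · intro n m hnm t
    refine indicator_le_indicator_of_subset (Icc_subset_Icc_right ?_) (fun _ => zero_le) t
    exact_mod_cast hnm

/-- Monotone convergence, applied to the integrals over `[0, n]` and to finite partial sums over
`i`. -/
theorem energy_eq (E : PVM H) (ρ : State H) :
    E.energy ρ = ∑' i, ENNReal.ofReal (ρ.eigenvalue i) *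
      ∫⁻ t, ENNReal.ofReal t ∂E.measure (ρ.basis i) := by
  have hmono : ∀ i, Monotone fun n : ℕ => ENNReal.ofReal (ρ.eigenvalue i) *
      ∫⁻ t in Icc (0 : ℝ) n, ENNReal.ofReal t ∂E.measure (ρ.basis i) := fun i n m hnm => by
    refine mul_le_mul_right (lintegral_mono_set (Icc_subset_Icc_right ?_)) _
    exact_mod_cast hnm
  refine le_antisymm (iSup_le fun n => ENNReal.tsum_le_tsum fun i =>
    mul_le_mul_right (setLIntegral_le_lintegral _ _) _) ?_
  refine ENNReal.summable.tsum_le_of_sum_le fun F => ?_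
  rw [Finset.sum_congr rfl fun i _ => by rw [← iSup_setLIntegral_Icc, ENNReal.mul_iSup],
    ENNReal.finsetSum_iSup_of_monotone hmono]
  exact iSup_mono fun n => ENNReal.sum_le_tsum F

theorem faProperty (E : PVM H) (ρ : State H)
    (ht : Tendsto (fun β : ℝ => E.traceExp β ^ β) (𝓝[>] 0) (𝓝 1)) (he : E.energy ρ < ⊤) :
    ρ.FAProperty := by
  refine ρ.faProperty_of_measures (ν := fun i => E.measure (ρ.basis i)) (fun i _ => ?_) ?_ ?_
  · rw [measure_apply _ _ MeasurableSet.univ, E.proj_univ, one_apply_eq_self,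
      inner_self_eq_norm_sq, ρ.basis.orthonormal.norm_eq_one]
    simp
  · rwa [← energy_eq]
  · simp only [← traceExp_eq]
    exact SubExp.of_tendsto ht

end PVM

namespace State

theorem inner_eq_zero_of_mem_supp (σ : State H) {x : H} (hx : x ∈ σ.supp) {j : σ.Index}
    (hj : ¬ 0 < σ.eigenvalue j) : ⟪σ.basis j, x⟫_ℂ = 0 := by
  have hj0 : σ.eigenvalue j = 0 := le_antisymm (not_lt.1 hj) (σ.eigenvalue_nonneg j)
  have hle : σ.supp ≤ (Submodule.span ℂ {σ.basis j})ᗮ := by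
    refine Submodule.topologicalClosure_minimal _ (iSup_le fun t z hz => ?_)
      (Submodule.isClosed_orthogonal _)
    rw [Submodule.mem_orthogonal_singleton_iff_inner_right]
    have h := σ.isPositive.isSymmetric (σ.basis j) z
    rw [Module.End.mem_eigenspace_iff.1 hz, ContinuousLinearMap.coe_coe, σ.op_basis, hj0,
      inner_smul_right] at h
    have ht : ((t : ℝ) : ℂ) ≠ 0 := by exact_mod_cast t.2.ne'
    simpa [ht] using h
  exact (Submodule.mem_orthogonal_singleton_iff_inner_right.1 (hle hx))

theorem basis_mem_supp (ρ : State H) {i : ρ.Index} (hi : 0 < ρ.eigenvalue i) :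
    ρ.basis i ∈ ρ.supp :=
  Submodule.le_topologicalClosure _ (Submodule.mem_iSup_of_mem ⟨ρ.eigenvalue i, hi⟩
    (Module.End.mem_eigenspace_iff.2 (ρ.op_basis i)))

/-- The observable is `-log σ`: its partition function at `q` is `Tr σ ^ q`, because `exp (q * log
μ) = μ ^ q`, and its mean energy is controlled by `negLogForm`. -/
theorem faProperty_of_negLogForm {ρ σ : State H} (hsupp : ρ.supp ≤ σ.supp)
    (hE : ∑' i, ENNReal.ofReal (ρ.eigenvalue i) * σ.negLogForm (ρ.basis i) < ⊤)
    (hS : Tendsto (fun q : ℝ => posTrace (σ.op ^ q) ^ q) (𝓝[>] 0) (𝓝 1)) : ρ.FAProperty := by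
  -- The kernel of `σ` must be excluded: since `Real.log 0 = 0`, it would count as levels of zero
  -- energy, each adding `1` to the partition function. Eigenvectors of `ρ` with positive eigenvalue
  -- lose no mass, as they lie in the support of `σ`.
  set w : ρ.Index → σ.Index → ℝ≥0∞ := fun i =>
    {j | 0 < σ.eigenvalue j}.indicator fun j => ENNReal.ofReal (‖⟪σ.basis j, ρ.basis i⟫_ℂ‖ ^ 2)
    with hw
  refine ρ.faProperty_of_measures (ν := fun i => Measure.sum fun j =>
    w i j • Measure.dirac (-Real.log (σ.eigenvalue j))) (fun i hi => ?_) ?_ ?_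
  · have h1 : ∀ j, w i j = ENNReal.ofReal (‖⟪σ.basis j, ρ.basis i⟫_ℂ‖ ^ 2) := fun j => by
      by_cases hj : 0 < σ.eigenvalue j
      · exact indicator_of_mem (by exact hj) _
      · rw [σ.inner_eq_zero_of_mem_supp (hsupp (ρ.basis_mem_supp hi)) hj, hw]
        simp [hj]
    rw [Measure.sum_apply _ MeasurableSet.univ]
    simp only [Measure.smul_apply, measure_univ, smul_eq_mul, mul_one, h1]
    rw [tsum_ofReal_norm_inner_sq, ρ.basis.orthonormal.norm_eq_one]
    simp
  · refine lt_of_le_of_lt (ENNReal.tsum_le_tsum fun i => mul_le_mul_right ?_ _) hE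
    rw [lintegral_sum_measure, negLogForm]
    refine ENNReal.tsum_le_tsum fun j => ?_
    rw [lintegral_smul_measure, lintegral_dirac, smul_eq_mul, mul_comm]
    exact mul_le_mul_right (indicator_le_self' (fun _ _ => zero_le) j) _
  · refine (SubExp.of_tendsto hS).mono ?_
    filter_upwards [eventually_pos_nhdsGT] with q hq
    simp only [lintegral_sum_measure, lintegral_smul_measure, lintegral_dirac, smul_eq_mul]
    rw [ENNReal.tsum_comm, posTrace_rpow σ.isPositive hq σ.basis σ.op_basis]
    refine ENNReal.tsum_le_tsum fun j => ?_
    by_cases hj : 0 < σ.eigenvalue j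
    · have h1 : ∀ i, w i j = ENNReal.ofReal (‖⟪ρ.basis i, σ.basis j⟫_ℂ‖ ^ 2) := fun i => by
        rw [norm_inner_symm]
        exact indicator_of_mem (by exact hj) _
      simp only [h1]
      rw [ENNReal.tsum_mul_right, tsum_ofReal_norm_inner_sq, σ.basis.orthonormal.norm_eq_one,
        neg_mul_neg, mul_comm q, Real.exp_mul, Real.exp_log hj]
      simp
    · have h1 : ∀ i, w i j = 0 := fun i => indicator_of_notMem (by exact hj) _
      simp [h1]

/-- The negative parts of the relative entropy terms are dominated by the entropy terms, so no `∞ -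
∞` can occur and the positive parts have finite sum. Adding the entropy terms back cancels `λ log
λ`. -/
theorem tsum_negLogForm_lt_top {ρ σ : State H} (hρ : ρ.entropy < ⊤) (h : ρ.relEntropy σ < ⊤) :
    ρ.supp ≤ σ.supp ∧
      ∑' i, ENNReal.ofReal (ρ.eigenvalue i) * σ.negLogForm (ρ.basis i) < ⊤ := by
  have hsupp : ρ.supp ≤ σ.supp := by
    by_contra hn
    rw [relEntropy, if_neg hn] at h
    exact lt_irrefl _ h
  refine ⟨hsupp, ?_⟩
  rw [relEntropy, if_pos hsupp] at h
  rw [entropy_eq_tsum] at hρ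
  have hneg : ∑' i, (-relEntropyTerm ρ σ i).toENNReal < ⊤ := by
    refine lt_of_le_of_lt (ENNReal.tsum_le_tsum fun i => ?_) hρ
    rw [← EReal.real_coe_toENNReal (Real.negMulLog _)]
    refine EReal.toENNReal_le_toENNReal ?_
    rw [Real.negMulLog, neg_mul, EReal.coe_neg, EReal.neg_le_neg_iff, relEntropyTerm]
    exact le_add_of_nonneg_right (EReal.coe_ennreal_nonneg _)
  have hpos : ∑' i, (relEntropyTerm ρ σ i).toENNReal ≠ ⊤ := by
    intro htop
    rw [htop, EReal.coe_ennreal_top, EReal.top_sub] at h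
    · exact lt_irrefl _ h
    · simpa using hneg.ne
  refine lt_of_le_of_lt (ENNReal.tsum_le_tsum fun i => ?_)
    ((ENNReal.tsum_add (f := fun i => (relEntropyTerm ρ σ i).toENNReal) (g := fun i =>
      ENNReal.ofReal (Real.negMulLog (ρ.eigenvalue i)))).trans_lt
      (ENNReal.add_lt_top.2 ⟨hpos.lt_top, hρ⟩))
  rw [← EReal.real_coe_toENNReal (Real.negMulLog _)]
  refine le_trans (le_of_eq ?_) EReal.toENNReal_add_le
  rw [relEntropyTerm, add_right_comm, ← EReal.coe_add, Real.negMulLog, neg_mul, add_neg_cancel,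
    EReal.coe_zero, zero_add, EReal.toENNReal_coe]

theorem faProperty_of_log (ρ : State H) {q : ℝ} (hq : 2 < q)
    (h : (∑' i, ENNReal.ofReal (ρ.eigenvalueSeq i * Real.log (i + 1) ^ q)) < ⊤) : ρ.FAProperty :=
  ρ.faProperty_of_subExp (fun i => Real.rpow_nonneg
    (Real.log_nonneg (by linarith [i.cast_nonneg (α := ℝ)])) _) h (subExp_log_rpow hq)

end State

end QState

namespace QState

variable {H : Type*} [NormedAddCommGroup H] [InnerProductSpace ℂ H] [CompleteSpace H]

/-! ### Diagonal states -/

namespace State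

theorem exists_of_eigenvalues {ι : Type*} (b : HilbertBasis ι ℂ H) {m : ι → ℝ}
    (h0 : ∀ i, 0 ≤ m i) (h1 : ∑' i, ENNReal.ofReal (m i) = 1) :
    ∃ σ : State H, ∀ i, σ.op (b i) = (m i : ℂ) • b i := by
  have hm : ∀ i, |m i| ≤ 1 := fun i => by
    have h := ENNReal.le_tsum (f := fun i => ENNReal.ofReal (m i)) i
    rw [h1] at h
    rw [abs_of_nonneg (h0 i)]
    simpa using h
  obtain ⟨A, hA⟩ := exists_diagonal b m hm
  have hpos := diagonal_isPositive hA h0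
  exact ⟨⟨A, hpos, by rw [posTrace_eq_tsum_eigenvalue hpos b (diagonal_basis hA), h1]⟩,
    diagonal_basis hA⟩

/-- The chosen eigenbasis of `σ` need not contain `x`, but `x` is orthogonal to every basis vector
whose eigenvalue differs from `t`. -/
theorem negLogForm_of_eigenvector (σ : State H) {x : H} (hx : ‖x‖ = 1) {t : ℝ}
    (h : σ.op x = (t : ℂ) • x) : σ.negLogForm x = ENNReal.ofReal (-Real.log t) := by
  have hj : ∀ j, ENNReal.ofReal (-Real.log (σ.eigenvalue j)) *
        ENNReal.ofReal (‖⟪σ.basis j, x⟫_ℂ‖ ^ 2) =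
      ENNReal.ofReal (-Real.log t) * ENNReal.ofReal (‖⟪σ.basis j, x⟫_ℂ‖ ^ 2) := fun j => by
    rcases eq_or_ne ⟪σ.basis j, x⟫_ℂ 0 with h0 | h0
    · simp [h0]
    have hs := σ.isPositive.isSymmetric (σ.basis j) x
    rw [ContinuousLinearMap.coe_coe, σ.op_basis, h, inner_smul_right, inner_smul_left,
      Complex.conj_ofReal] at hs
    have : σ.eigenvalue j = t := by exact_mod_cast mul_right_cancel₀ h0 hs
    rw [this]
  rw [negLogForm, tsum_congr hj, ENNReal.tsum_mul_left, tsum_ofReal_norm_inner_sq, hx]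
  simp

theorem mem_supp_of_eigenvector (σ : State H) {x : H} {t : ℝ} (ht : 0 < t)
    (h : σ.op x = (t : ℂ) • x) : x ∈ σ.supp :=
  Submodule.le_topologicalClosure _ (Submodule.mem_iSup_of_mem ⟨t, ht⟩
    (Module.End.mem_eigenspace_iff.2 h))

/-- An eigenvector with positive eigenvalue has no component along basis vectors with eigenvalue
zero. -/
theorem supp_le {ρ : State H} {K : Submodule ℂ H} (hK : IsClosed (K : Set H))
    (h : ∀ i, 0 < ρ.eigenvalue i → ρ.basis i ∈ K) : ρ.supp ≤ K := by
  refine Submodule.topologicalClosure_minimal _ (iSup_le fun t x hx => ?_) hK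
  refine hK.mem_of_tendsto (ρ.basis.hasSum_repr x) (Eventually.of_forall fun F => ?_)
  refine Submodule.sum_mem _ fun i _ => ?_
  by_cases hi : 0 < ρ.eigenvalue i
  · exact K.smul_mem _ (h i hi)
  · rw [ρ.basis.repr_apply_apply,
      ρ.inner_eq_zero_of_mem_supp (ρ.mem_supp_of_eigenvector t.2
        (Module.End.mem_eigenspace_iff.1 hx)) hi, zero_smul]
    exact K.zero_mem

theorem relEntropy_lt_top {ρ σ : State H} (hsupp : ρ.supp ≤ σ.supp)
    (hE : ∑' i, ENNReal.ofReal (ρ.eigenvalue i) * σ.negLogForm (ρ.basis i) < ⊤) :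
    ρ.relEntropy σ < ⊤ := by
  rw [relEntropy, if_pos hsupp, sub_eq_add_neg]
  have hpos : ∑' i, (relEntropyTerm ρ σ i).toENNReal < ⊤ := by
    refine lt_of_le_of_lt (ENNReal.tsum_le_tsum fun i => ?_) hE
    refine EReal.toENNReal_add_le.trans ?_
    rw [EReal.toENNReal_coe, EReal.real_coe_toENNReal, ENNReal.ofReal_eq_zero.2, zero_add]
    exact mul_nonpos_of_nonneg_of_nonpos (ρ.eigenvalue_nonneg i)
      (Real.log_nonpos (ρ.eigenvalue_nonneg i) (ρ.eigenvalue_le_one i))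
  refine EReal.add_lt_top ?_ ?_
  · simpa using hpos.ne
  · rw [Ne, EReal.neg_eq_top_iff]
    exact EReal.coe_ennreal_ne_bot _

/-- Gibbs' inequality for one term, from `log x ≤ x - 1` at `x = m / l`. -/
theorem negMulLog_le {l m : ℝ} (hl : 0 ≤ l) (hm : 0 ≤ m) (h : 0 < l → 0 < m) :
    Real.negMulLog l ≤ l * -Real.log m + m := by
  rcases hl.eq_or_lt with rfl | hl
  · simpa using hm
  have hm' := h hl
  have h1 := Real.log_le_sub_one_of_pos (div_pos hm' hl)
  rw [Real.log_div hm'.ne' hl.ne'] at h1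
  have h2 := mul_le_mul_of_nonneg_left h1 hl.le
  have h3 : l * (m / l - 1) = m - l := by field_simp
  rw [Real.negMulLog]
  linarith

theorem entropy_lt_top (ρ : State H) {m : ρ.Index → ℝ} (hm : ∀ i, 0 ≤ m i)
    (hpos : ∀ i, 0 < ρ.eigenvalue i → 0 < m i) (hsum : ∑' i, ENNReal.ofReal (m i) < ⊤)
    (hE : ∑' i, ENNReal.ofReal (ρ.eigenvalue i) * ENNReal.ofReal (-Real.log (m i)) < ⊤) :
    ρ.entropy < ⊤ := by
  rw [entropy_eq_tsum]
  refine lt_of_le_of_lt (ENNReal.tsum_le_tsum fun i => ?_)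
    (ENNReal.tsum_add.trans_lt (ENNReal.add_lt_top.2 ⟨hE, hsum⟩))
  rw [← ENNReal.ofReal_mul (ρ.eigenvalue_nonneg i)]
  exact (ENNReal.ofReal_le_ofReal (negMulLog_le (ρ.eigenvalue_nonneg i) (hm i) (hpos i))).trans
    ENNReal.ofReal_add_le

theorem FAProperty.exists_state {ρ : State H} (h : ρ.FAProperty) :
    ρ.entropy < ⊤ ∧ ∃ σ : State H, ρ.relEntropy σ < ⊤ ∧
      (∀ q : ℝ, 0 < q → posTrace (σ.op ^ q) < ⊤) ∧
        Tendsto (fun q : ℝ => posTrace (σ.op ^ q) ^ q) (𝓝[>] 0) (𝓝 1) := by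
  obtain ⟨g, hg, hE, hlim⟩ := h
  have hS := SubExp.of_tendsto hlim
  set S : ℝ → ℝ≥0∞ := fun β => ∑' n, ENNReal.ofReal (Real.exp (-β * g n)) with hSdef
  -- The sum decreases in its parameter because `g ≥ 0`, so finiteness near zero gives finiteness
  -- everywhere.
  have hSfin : ∀ q, 0 < q → S q < ⊤ := fun q hq => by
    obtain ⟨β, h1, h2⟩ := (hS.eventually_lt_top.and (Filter.Eventually.filter_mono
      nhdsWithin_le_nhds (eventually_lt_nhds hq))).exists
    refine lt_of_le_of_lt (ENNReal.tsum_le_tsum fun n => ENNReal.ofReal_le_ofReal ?_) h1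
    rw [Real.exp_le_exp]
    nlinarith [mul_le_mul_of_nonneg_right h2.le (hg n)]
  set P := {i | 0 < ρ.eigenvalue i} with hP
  obtain ⟨i₀, hi₀⟩ := ρ.exists_eigenvalue_pos
  have hle : ∀ F : ℕ → ℝ≥0∞, ∑' i, P.indicator (fun i => F (ρ.rank i)) i ≤ ∑' n, F n :=
    ρ.tsum_indicator_rank_le
  set Z : ℝ≥0∞ := ∑' i, P.indicator (fun i => ENNReal.ofReal (Real.exp (-g (ρ.rank i)))) i with hZ
  have hZtop : Z ≠ ⊤ := by
    refine (lt_of_le_of_lt (hle fun n => ENNReal.ofReal (Real.exp (-g n))) ?_).ne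
    simpa [hSdef] using hSfin 1 one_pos
  have hZ0 : 0 < Z.toReal := by
    refine ENNReal.toReal_pos (fun h => ?_) hZtop
    have := ENNReal.tsum_eq_zero.1 h i₀
    rw [indicator_of_mem (by exact hi₀), ENNReal.ofReal_eq_zero] at this
    exact this.not_gt (Real.exp_pos _)
  -- Normalization: adding `c` to the levels divides the weights `exp (-g)` by `Z`. Restricting the
  -- weights to positive eigenvalues of `ρ` only decreases the partition function.
  set c := Real.log Z.toReal with hc
  set m : ρ.Index → ℝ := P.indicator fun i => Real.exp (-(g (ρ.rank i) + c)) with hm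
  have hm0 : ∀ i, 0 ≤ m i := indicator_nonneg fun i _ => (Real.exp_pos _).le
  have hmP : ∀ i, 0 < ρ.eigenvalue i → m i = Real.exp (-(g (ρ.rank i) + c)) := fun i hi =>
    indicator_of_mem (by exact hi) _
  have hmN : ∀ i, ¬ 0 < ρ.eigenvalue i → m i = 0 := fun i hi => indicator_of_notMem (by exact hi) _
  have hpow : ∀ q, 0 < q → ∀ i, ENNReal.ofReal (m i ^ q) = ENNReal.ofReal (Real.exp (-q * c)) *
      P.indicator (fun i => ENNReal.ofReal (Real.exp (-q * g (ρ.rank i)))) i := fun q hq i => by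
    by_cases hi : 0 < ρ.eigenvalue i
    · rw [hmP i hi, indicator_of_mem (by exact hi), ← ENNReal.ofReal_mul (by positivity),
        ← Real.exp_add, ← Real.exp_mul]
      congr 2
      ring
    · rw [hmN i hi, indicator_of_notMem (by exact hi), Real.zero_rpow hq.ne']
      simp
  have hm1 : ∑' i, ENNReal.ofReal (m i) = 1 := by
    have h1 : ∀ i, ENNReal.ofReal (m i) = ENNReal.ofReal (Real.exp (-c)) *
        P.indicator (fun i => ENNReal.ofReal (Real.exp (-g (ρ.rank i)))) i := fun i => by
      simpa using hpow 1 one_pos i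
    rw [tsum_congr h1, ENNReal.tsum_mul_left, ← hZ, Real.exp_neg, hc, Real.exp_log hZ0,
      ENNReal.ofReal_inv_of_pos hZ0, ENNReal.ofReal_toReal hZtop,
      ENNReal.inv_mul_cancel (fun h => by simp [h] at hZ0) hZtop]
  obtain ⟨σ, hσ⟩ := exists_of_eigenvalues ρ.basis hm0 hm1
  have hlog : ∑' i, ENNReal.ofReal (ρ.eigenvalue i) * ENNReal.ofReal (-Real.log (m i)) < ⊤ := by
    have hE' : ∑' i, ENNReal.ofReal (ρ.eigenvalue i) * ENNReal.ofReal (g (ρ.rank i)) < ⊤ := by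
      rw [ρ.tsum_eigenvalue_mul_rank fun n => ENNReal.ofReal (g n)]
      simpa only [ENNReal.ofReal_mul (ρ.eigenvalueSeq_nonneg _)] using hE
    have hc' : ∑' i, ENNReal.ofReal (ρ.eigenvalue i) * ENNReal.ofReal c < ⊤ := by
      rw [ENNReal.tsum_mul_right, ρ.tsum_eigenvalue, one_mul]
      exact ENNReal.ofReal_lt_top
    refine lt_of_le_of_lt (ENNReal.tsum_le_tsum fun i => ?_)
      (ENNReal.tsum_add.trans_lt (ENNReal.add_lt_top.2 ⟨hE', hc'⟩))
    by_cases hi : 0 < ρ.eigenvalue i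
    · rw [← mul_add, hmP i hi, Real.log_exp, neg_neg]
      exact mul_le_mul_right ENNReal.ofReal_add_le _
    · rw [ENNReal.ofReal_eq_zero.2 (not_lt.1 hi), zero_mul]
      exact zero_le
  have hTr : ∀ q, 0 < q → posTrace (σ.op ^ q) ≤ ENNReal.ofReal (Real.exp (-q * c)) * S q :=
    fun q hq => by
    rw [posTrace_rpow σ.isPositive hq ρ.basis hσ, tsum_congr (hpow q hq), ENNReal.tsum_mul_left]
    exact mul_le_mul_right (hle fun n => ENNReal.ofReal (Real.exp (-q * g n))) _
  refine ⟨ρ.entropy_lt_top hm0 (fun i hi => ?_) (hm1.trans_lt ENNReal.one_lt_top) hlog,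
    σ, relEntropy_lt_top ?_ ?_, fun q hq => ?_, ?_⟩
  · rw [hmP i hi]
    exact Real.exp_pos _
  · refine supp_le (Submodule.isClosed_topologicalClosure _) fun i hi => ?_
    refine σ.mem_supp_of_eigenvector ?_ (hσ i)
    rw [hmP i hi]
    exact Real.exp_pos _
  · simpa only [σ.negLogForm_of_eigenvector (ρ.basis.orthonormal.norm_eq_one _) (hσ _)] using hlog
  · exact (hTr q hq).trans_lt (ENNReal.mul_lt_top ENNReal.ofReal_lt_top (hSfin q hq))
  -- `C` is the level of the eigenvector `i₀`, which alone gives the lower bound; for `q < 1` the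
  -- normalizing factor is at most `exp |c|`.
  · refine SubExp.tendsto_rpow (C := g (ρ.rank i₀) + c) ?_ ?_
    · refine ((SubExp.const (C := ENNReal.ofReal (Real.exp |c|)) ENNReal.ofReal_ne_top).mul
        hS).mono ?_
      filter_upwards [eventually_pos_nhdsGT, Filter.Eventually.filter_mono
        nhdsWithin_le_nhds (eventually_lt_nhds (zero_lt_one' ℝ))] with q hq hq1
      refine (hTr q hq).trans (mul_le_mul_left (ENNReal.ofReal_le_ofReal
        (Real.exp_le_exp.2 ?_)) _)
      refine (le_abs_self _).trans ?_
      rw [abs_mul, abs_neg, abs_of_pos hq]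
      exact mul_le_of_le_one_left (abs_nonneg c) hq1.le
    · filter_upwards [eventually_pos_nhdsGT] with q hq
      rw [posTrace_rpow σ.isPositive hq ρ.basis hσ]
      refine le_trans (le_of_eq ?_) (ENNReal.le_tsum i₀)
      rw [hmP i₀ hi₀, ← Real.exp_mul]
      congr 2
      ring

end State

end QState

namespace QState

variable {H : Type*} [NormedAddCommGroup H] [InnerProductSpace ℂ H]
variable {ι : Type*}

/-! ### Unbounded diagonal operators -/

/-- The maximal domain of multiplication by `h` in the basis `b`. -/
noncomputable def diagDomain (b : HilbertBasis ι ℂ H) (h : ι → ℝ) : Submodule ℂ H where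
  carrier := {x | Memℓp (E := fun _ : ι => ℂ) (fun i => (h i : ℂ) * b.repr x i) 2}
  zero_mem' := by
    have h0 : (fun i => (h i : ℂ) * b.repr 0 i) = 0 := funext fun i => by simp
    rw [mem_ofPred_eq, h0]
    exact zero_memℓp
  add_mem' := fun {x y} hx hy => by
    have hadd : (fun i => (h i : ℂ) * b.repr (x + y) i) =
        (fun i => (h i : ℂ) * b.repr x i) + fun i => (h i : ℂ) * b.repr y i :=
      funext fun i => by simp [mul_add]
    rw [mem_ofPred_eq, hadd]
    exact hx.add hy
  smul_mem' := fun c x hx => by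
    have hsmul : (fun i => (h i : ℂ) * b.repr (c • x) i) =
        c • fun i => (h i : ℂ) * b.repr x i := funext fun i => by simp [mul_left_comm]
    rw [mem_ofPred_eq, hsmul]
    exact hx.const_smul c

/-- The operator with eigenvectors `b i` and eigenvalues `h i` on its maximal domain. -/
noncomputable def diagOp (b : HilbertBasis ι ℂ H) (h : ι → ℝ) : H →ₗ.[ℂ] H where
  domain := diagDomain b h
  toFun :=
    { toFun := fun x => b.repr.symm ⟨fun i => (h i : ℂ) * b.repr x i, x.2⟩
      map_add' := fun x y => by
        rw [← map_add]
        congr 1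
        refine lp.ext (funext fun i => ?_)
        simp [mul_add]
        rfl
      map_smul' := fun c x => by
        rw [RingHom.id_apply, ← map_smul]
        congr 1
        refine lp.ext (funext fun i => ?_)
        simp [mul_left_comm] }

theorem mem_diagOp_domain (b : HilbertBasis ι ℂ H) (h : ι → ℝ) (x : H) :
    x ∈ (diagOp b h).domain ↔ Summable fun i => h i ^ 2 * ‖⟪b i, x⟫_ℂ‖ ^ 2 := by
  change Memℓp (E := fun _ : ι => ℂ) (fun i => (h i : ℂ) * b.repr x i) 2 ↔ _
  rw [memℓp_gen_iff (by norm_num)]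
  refine summable_congr fun i => ?_
  rw [b.repr_apply_apply, norm_mul, Complex.norm_real]
  simp [mul_pow]

theorem inner_diagOp (b : HilbertBasis ι ℂ H) (h : ι → ℝ) (x : (diagOp b h).domain) (i : ι) :
    ⟪b i, diagOp b h x⟫_ℂ = h i * ⟪b i, (x : H)⟫_ℂ := by
  change ⟪b i, b.repr.symm ⟨fun i => (h i : ℂ) * b.repr (x : H) i, x.2⟩⟫_ℂ = _
  rw [← b.repr_apply_apply, ← b.repr_apply_apply]
  simp

theorem basis_mem_diagOp_domain (b : HilbertBasis ι ℂ H) (h : ι → ℝ) (i : ι) :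
    b i ∈ (diagOp b h).domain := by
  classical
  rw [mem_diagOp_domain]
  refine summable_of_ne_finset_zero (s := {i}) fun j hj => ?_
  rw [inner_basis_basis, if_neg (by simpa using hj)]
  simp

theorem dense_diagOp_domain (b : HilbertBasis ι ℂ H) (h : ι → ℝ) :
    Dense ((diagOp b h).domain : Set H) := by
  refine Dense.mono (s₁ := (Submodule.span ℂ (range b) : Set H)) ?_ ?_
  · exact Submodule.span_le.2 (range_subset_iff.2 (basis_mem_diagOp_domain b h))
  · rw [Submodule.dense_iff_topologicalClosure_eq_top]
    exact b.dense_span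

theorem diagOp_isFormalAdjoint (b : HilbertBasis ι ℂ H) (h : ι → ℝ) :
    (diagOp b h).IsFormalAdjoint (diagOp b h) := fun x y => by
  refine (b.hasSum_inner_mul_inner _ _).unique ?_
  refine (b.hasSum_inner_mul_inner _ _).congr_fun fun i => ?_
  rw [inner_diagOp, ← inner_conj_symm, inner_diagOp, map_mul, inner_conj_symm,
    Complex.conj_ofReal]
  ring

/-- The projection onto the closed span of the `b i` with `h i ∈ s`. -/
noncomputable def diagProj (b : HilbertBasis ι ℂ H) (h : ι → ℝ) (s : Set ℝ) : H →L[ℂ] H :=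
  (exists_diagonal b (fun i => s.indicator 1 (h i)) (C := 1) fun i => by
    by_cases hi : h i ∈ s <;> simp [hi]).choose

theorem inner_diagProj (b : HilbertBasis ι ℂ H) (h : ι → ℝ) (s : Set ℝ) (x : H) (i : ι) :
    ⟪b i, diagProj b h s x⟫_ℂ = (s.indicator (1 : ℝ → ℝ) (h i) : ℝ) * ⟪b i, x⟫_ℂ :=
  (exists_diagonal b (fun i => s.indicator 1 (h i)) (C := 1) fun i => by
    by_cases hi : h i ∈ s <;> simp [hi]).choose_spec x i

theorem hasSum_diagProj (b : HilbertBasis ι ℂ H) (h : ι → ℝ) (s : Set ℝ) (x : H) :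
    HasSum (fun i : h ⁻¹' s => ⟪b i, x⟫_ℂ • b i) (diagProj b h s x) := by
  refine (hasSum_subtype_iff_indicator (f := fun i => ⟪b i, x⟫_ℂ • b i)).2 ?_
  refine (b.hasSum_repr (diagProj b h s x)).congr_fun fun i => ?_
  rw [b.repr_apply_apply, inner_diagProj]
  by_cases hi : h i ∈ s
  · rw [indicator_of_mem (by exact hi), indicator_of_mem hi]
    simp
  · rw [indicator_of_notMem (by exact hi), indicator_of_notMem hi]
    simp

variable [CompleteSpace H]

/-- Testing the adjoint against basis vectors shows that its value at `y` has coefficients `h i * ⟪b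
i, y⟫_ℂ` up to conjugation. They are square summable, so `y` already lies in the maximal domain. -/
theorem diagOp_isSelfAdjoint (b : HilbertBasis ι ℂ H) (h : ι → ℝ) :
    IsSelfAdjoint (diagOp b h) := by
  rw [LinearPMap.isSelfAdjoint_def]
  have hd := dense_diagOp_domain b h
  have hle := (diagOp_isFormalAdjoint b h).le_adjoint hd
  refine (LinearPMap.eq_of_le_of_domain_eq hle (le_antisymm hle.1 fun y hy => ?_)).symm
  rw [mem_diagOp_domain]
  refine (hasSum_norm_inner_sq b ((diagOp b h).adjoint ⟨y, hy⟩)).summable.congr fun i => ?_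
  have hi := LinearPMap.adjoint_isFormalAdjoint hd ⟨y, hy⟩ ⟨b i, basis_mem_diagOp_domain b h i⟩
  have hb : diagOp b h ⟨b i, basis_mem_diagOp_domain b h i⟩ = (h i : ℂ) • b i := by
    classical
    refine eq_of_inner_basis_eq b fun j => ?_
    rw [inner_diagOp, inner_smul_right, inner_basis_basis]
    split_ifs with hij
    · rw [hij]
    · simp
  rw [hb, inner_smul_right] at hi
  rw [norm_inner_symm, hi, norm_mul, Complex.norm_real, Real.norm_eq_abs, mul_pow, sq_abs,
    norm_inner_symm]

theorem diagOp_isPositiveOperator (b : HilbertBasis ι ℂ H) {h : ι → ℝ} (h0 : ∀ i, 0 ≤ h i) :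
    IsPositiveOperator (diagOp b h) :=
  ⟨diagOp_isSelfAdjoint b h, fun x => (hasSum_re_inner_diagonal (inner_diagOp b h x)).nonneg
    fun i => mul_nonneg (h0 i) (by positivity)⟩

/-- The spectral measure of `diagOp b h`. -/
noncomputable def diagPVM (b : HilbertBasis ι ℂ H) (h : ι → ℝ) : PVM H where
  proj := diagProj b h
  isStarProjection s _ := by
    refine ⟨?_, ContinuousLinearMap.isSelfAdjoint_iff_isSymmetric.2
      (diagonal_isSymmetric (inner_diagProj b h s))⟩
    refine ContinuousLinearMap.ext fun x => eq_of_inner_basis_eq b fun i => ?_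
    change ⟪b i, diagProj b h s (diagProj b h s x)⟫_ℂ = _
    rw [inner_diagProj, inner_diagProj]
    by_cases hi : h i ∈ s <;> simp [hi]
  proj_univ := ContinuousLinearMap.ext fun x => eq_of_inner_basis_eq b fun i => by
    simp [inner_diagProj]
  proj_inter s t _ _ := ContinuousLinearMap.ext fun x => eq_of_inner_basis_eq b fun i => by
    change _ = ⟪b i, diagProj b h s (diagProj b h t x)⟫_ℂ
    rw [inner_diagProj, inner_diagProj, inner_diagProj]
    by_cases hs : h i ∈ s <;> by_cases ht : h i ∈ t <;> simp [hs, ht]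
  hasSum_iUnion s _ hd x := by
    -- Countable additivity is a regrouping of one basis expansion along the disjoint preimages.
    let f : (Σ n, h ⁻¹' s n) ≃ h ⁻¹' (⋃ n, s n) :=
      (Set.unionEqSigmaOfDisjoint fun n m hnm => (hd hnm).preimage h).symm.trans
        (Equiv.setCongr preimage_iUnion.symm)
    have hf : ∀ a, (f a : ι) = a.2 := fun a => rfl
    have h1 := f.hasSum_iff.2 (hasSum_diagProj b h (⋃ n, s n) x)
    exact h1.sigma fun n => hasSum_diagProj b h (s n) x

theorem diagPVM_measure (b : HilbertBasis ι ℂ H) (h : ι → ℝ) (x : H) :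
    (diagPVM b h).measure x =
      Measure.sum fun i => ENNReal.ofReal (‖⟪b i, x⟫_ℂ‖ ^ 2) • Measure.dirac (h i) := by
  ext s hs
  have hsum := hasSum_re_inner_diagonal (inner_diagProj b h s x)
  have hnn : ∀ i, 0 ≤ s.indicator (1 : ℝ → ℝ) (h i) * ‖⟪b i, x⟫_ℂ‖ ^ 2 := fun i =>
    mul_nonneg (indicator_nonneg (fun _ _ => zero_le_one) _) (by positivity)
  rw [PVM.measure_apply _ _ hs, Measure.sum_apply _ hs]
  change ENNReal.ofReal (RCLike.re ⟪x, diagProj b h s x⟫_ℂ) = _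
  rw [← hsum.tsum_eq, ENNReal.ofReal_tsum_of_nonneg hnn hsum.summable]
  refine tsum_congr fun i => ?_
  rw [Measure.smul_apply, Measure.dirac_apply' _ hs]
  by_cases hi : h i ∈ s <;> simp [hi]

theorem lintegral_diagPVM_measure (b : HilbertBasis ι ℂ H) (h : ι → ℝ) (x : H) (f : ℝ → ℝ≥0∞) :
    ∫⁻ t, f t ∂(diagPVM b h).measure x = ∑' i, ENNReal.ofReal (‖⟪b i, x⟫_ℂ‖ ^ 2) * f (h i) := by
  simp only [diagPVM_measure, lintegral_sum_measure, lintegral_smul_measure, lintegral_dirac,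
    smul_eq_mul]

theorem diagPVM_measure_basis (b : HilbertBasis ι ℂ H) (h : ι → ℝ) (i : ι) :
    (diagPVM b h).measure (b i) = Measure.dirac (h i) := by
  classical
  ext s hs
  rw [← lintegral_indicator_one hs, lintegral_diagPVM_measure, tsum_eq_single i fun j hj => ?_,
    ← lintegral_indicator_one hs, lintegral_dirac, inner_basis_basis, if_pos rfl]
  · simp
  · rw [inner_basis_basis, if_neg hj]
    simp

theorem diagPVM_isSpectralMeasureOf (b : HilbertBasis ι ℂ H) (h : ι → ℝ) :
    (diagPVM b h).IsSpectralMeasureOf (diagOp b h) := by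
  have hdom : ∀ x, x ∈ (diagOp b h).domain ↔
      ∫⁻ t, ENNReal.ofReal (t ^ 2) ∂(diagPVM b h).measure x < ⊤ := by
    intro x
    rw [mem_diagOp_domain, lintegral_diagPVM_measure]
    simp only [← ENNReal.ofReal_mul (sq_nonneg ‖_‖), mul_comm (‖_‖ ^ 2)]
    refine ⟨fun hs => hs.tsum_ofReal_lt_top, fun hs => ?_⟩
    exact (ENNReal.summable_toReal hs.ne).congr fun i => ENNReal.toReal_ofReal (by positivity)
  refine ⟨hdom, fun x => ?_⟩
  set μ := (diagPVM b h).measure (x : H) with hμ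
  have huniv : μ univ < ⊤ := by
    rw [hμ, PVM.measure_apply _ _ MeasurableSet.univ]
    exact ENNReal.ofReal_lt_top
  -- The measure is finite and `|t| ≤ 1 + t ^ 2`, so a finite second moment suffices.
  have hint : Integrable (fun t : ℝ => t) μ := by
    refine ⟨by fun_prop, ?_⟩
    refine lt_of_le_of_lt (lintegral_mono (g := fun t => 1 + ENNReal.ofReal (t ^ 2)) fun t => ?_) ?_
    · beta_reduce
      rw [Real.enorm_eq_ofReal_abs, ← ENNReal.ofReal_one, ← ENNReal.ofReal_add zero_le_one
        (sq_nonneg t)]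
      refine ENNReal.ofReal_le_ofReal ?_
      nlinarith [sq_abs t, sq_nonneg (|t| - 1), abs_nonneg t]
    · rw [lintegral_add_left measurable_const, lintegral_one]
      exact ENNReal.add_lt_top.2 ⟨huniv, (hdom x).1 x.2⟩
  rw [hμ, diagPVM_measure] at hint
  have hs := hasSum_integral_measure hint
  rw [hμ, diagPVM_measure]
  refine (hasSum_inner_diagonal (inner_diagOp b h x)).unique ?_
  refine (hs.mapL Complex.ofRealCLM).congr_fun fun i => ?_
  rw [integral_smul_measure, integral_dirac, ENNReal.toReal_ofReal (by positivity), smul_eq_mul,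
    mul_comm]
  rfl

theorem State.FAProperty.exists_operator [TopologicalSpace.SeparableSpace H] {ρ : State H}
    (hρ : ρ.FAProperty) :
    ∃ (G : H →ₗ.[ℂ] H) (E : PVM H), IsPositiveOperator G ∧ E.IsSpectralMeasureOf G ∧
      Tendsto (fun β : ℝ => E.traceExp β ^ β) (𝓝[>] 0) (𝓝 1) ∧ E.energy ρ < ⊤ := by
  classical
  obtain ⟨g, hg, hE, hlim⟩ := hρ
  have := countable_of_hilbertBasis ρ.basis
  obtain ⟨f, hf⟩ := exists_injective_nat ρ.Index
  -- The kernel of `ρ` may be infinite-dimensional, so its levels must grow to keep the trace of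
  -- `exp (-β G)` finite; separability provides the numbering `f`. These levels add nothing to the
  -- energy.
  let h : ρ.Index → ℝ := fun i =>
    if 0 < ρ.eigenvalue i then g (ρ.rank i) else Real.log (f i + 1) ^ (3 : ℝ)
  have h0 : ∀ i, 0 ≤ h i := fun i => by
    simp only [h]
    split_ifs
    · exact hg _
    · exact Real.rpow_nonneg (Real.log_nonneg (by linarith [(f i).cast_nonneg (α := ℝ)])) _
  obtain ⟨i₀, -⟩ := ρ.exists_eigenvalue_pos
  have htr : ∀ β, (diagPVM ρ.basis h).traceExp β =
      ∑' i, ENNReal.ofReal (Real.exp (-β * h i)) := fun β => by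
    rw [PVM.traceExp_eq _ ρ.basis]
    simp only [diagPVM_measure_basis, lintegral_dirac]
  refine ⟨diagOp ρ.basis h, diagPVM ρ.basis h, diagOp_isPositiveOperator _ h0,
    diagPVM_isSpectralMeasureOf _ _, SubExp.tendsto_rpow (C := h i₀) ?_ ?_, ?_⟩
  · refine ((SubExp.of_tendsto hlim).add (subExp_log_rpow (q := 3) (by norm_num))).mono
      (Eventually.of_forall fun β => ?_)
    rw [htr]
    calc ∑' i, ENNReal.ofReal (Real.exp (-β * h i))
        ≤ ∑' i, ({i | 0 < ρ.eigenvalue i}.indicator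
            (fun i => ENNReal.ofReal (Real.exp (-β * g (ρ.rank i)))) i
            + ENNReal.ofReal (Real.exp (-β * Real.log (f i + 1) ^ (3 : ℝ)))) := by
          refine ENNReal.tsum_le_tsum fun i => ?_
          by_cases hi : 0 < ρ.eigenvalue i
          · rw [indicator_of_mem (by exact hi)]
            simp only [h, if_pos hi]
            exact le_self_add
          · simp only [h, if_neg hi]
            exact le_add_self
      _ ≤ _ := by
          rw [ENNReal.tsum_add]
          exact add_le_add (ρ.tsum_indicator_rank_le fun n => ENNReal.ofReal (Real.exp (-β * g n)))
            (ENNReal.tsum_comp_le_tsum_of_injective hf fun n : ℕ =>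
              ENNReal.ofReal (Real.exp (-β * Real.log (n + 1) ^ (3 : ℝ))))
  · exact Eventually.of_forall fun β => (ENNReal.le_tsum i₀).trans_eq (htr β).symm
  · rw [PVM.energy_eq]
    simp only [diagPVM_measure_basis, lintegral_dirac]
    simp only [ENNReal.ofReal_mul (ρ.eigenvalueSeq_nonneg _)] at hE
    rw [← ρ.tsum_eigenvalue_mul_rank fun n => ENNReal.ofReal (g n)] at hE
    refine lt_of_le_of_lt (ENNReal.tsum_le_tsum fun i => ?_) hE
    by_cases hi : 0 < ρ.eigenvalue i
    · simp only [h, if_pos hi, le_refl]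
    · rw [ENNReal.ofReal_eq_zero.2 (not_lt.1 hi), zero_mul]
      exact zero_le

end QState

theorem theorem1 {H : Type*} [NormedAddCommGroup H] [InnerProductSpace ℂ H] [CompleteSpace H]
    [TopologicalSpace.SeparableSpace H] (ρ : QState.State H) :
    List.TFAE [
      ρ.FAProperty,
      ∃ (G : H →ₗ.[ℂ] H) (E : QState.PVM H),
        QState.IsPositiveOperator G ∧ E.IsSpectralMeasureOf G ∧
          Tendsto (fun β : ℝ => E.traceExp β ^ β) (𝓝[>] 0) (𝓝 1) ∧ E.energy ρ < ⊤,
      ρ.entropy < ⊤ ∧ ∃ σ : QState.State H, ρ.relEntropy σ < ⊤ ∧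
        (∀ q : ℝ, 0 < q → QState.posTrace (σ.op ^ q) < ⊤) ∧
          Tendsto (fun q : ℝ => QState.posTrace (σ.op ^ q) ^ q) (𝓝[>] 0) (𝓝 1)] ∧
    ((∃ q : ℝ, 2 < q ∧
        (∑' i, ENNReal.ofReal (ρ.eigenvalueSeq i * Real.log (i + 1) ^ q)) < ⊤) →
      ρ.FAProperty) := by
  refine ⟨?_, fun ⟨q, hq, h⟩ => ρ.faProperty_of_log hq h⟩
  tfae_have 1 → 2 := fun h => h.exists_operator
  tfae_have 2 → 1 := fun ⟨_, E, _, _, ht, he⟩ => E.faProperty ρ ht he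
  tfae_have 1 → 3 := fun h => h.exists_state
  tfae_have 3 → 1 := fun ⟨hρ, σ, hr, _, ht⟩ =>
    have h := QState.State.tsum_negLogForm_lt_top hρ hr
    QState.State.faProperty_of_negLogForm h.1 h.2 ht
  tfae_finish
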